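/- **Notation.** For a probability distribution $F$ on $\mathbb{R}$ write $\overline F(x)=F((x,\infty))$, let $F^{*k}$ be its $k$-fold convolution power ($F^{*0}=\delta_0$), and for $\gamma>0$ put $m(F)=\int_{[0,\infty)}e^{\gamma y}F(dy)\in[0,\infty]$. All limits are for $x\to\infty$. For non-lattice $F$ write $F\in\mathcal L(\gamma)$ if $\overline F(x-t)/\overline F(x)\to e^{\gamma t}$ for every $t\in\mathbb{R}$; for $F$ with everywhere positive tail write $F\in\mathcal{OL}$ if $\limsup\overline F(x-t)/\overline F(x)<\infty$ for every $t\ne0$, and $F\in\mathcal{OS}$ if $\limsup\overline{F^{*2}}(x)/\overline F(x)<\infty$. If $\tau$ is a random variable with values in $\{0,1,2,\dots\}$ and $p_k=P(\tau=k)$, put $F^{*\tau}=\sum_{k\ge0}p_kF^{*k}$. **The class $\mathcal F_2(\gamma)$.** Let $s\in(1,2)$, $\alpha\in(1-s^{-1},s^{-1})$, $r=1+1/\alpha$, and let $a>1$ satisfy $a^r>2^{s+2}a$. Put $a_n=a^{r^n}$, $n\ge0$. Let $\eta$ be a random variable with $P(\eta=a_n)=Ca_n^{-\alpha}$, $n\ge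 0$, where $C=(\sum_{n\ge0}a_n^{-\alpha})^{-1}$, let $U$ be uniformly distributed on $(0,1)$ and independent of $\eta$, and let $F_0$ be the law of $\eta^{1/s}(1+U)^{1/s}$. For $\gamma>0$, $\mathcal F_2(\gamma)$ is the class of all distributions $F$ that arise from some such $F_0$ by $$\overline F(x)=\mathbf 1(x<0)+e^{-\gamma x}\,\overline{F_0}(x)\,\mathbf 1(x\ge0),\qquad x\in\mathbb{R}.$$ **Proposition 5.2.** Let $\gamma>0$ and $F\in\mathcal F_2(\gamma)$. Then 1. $\liminf\overline F(x-t)/\overline F(x)\ge e^{\gamma t}$ for all $t>0$; 2. $\overline F(x)=o\big(\overline{F^{*2}}(x)\big)$; 3. $m(F)=\infty$; 4. $F^{*k}\in\mathcal L(\gamma)\setminus\mathcal{OS}$ for all $k\ge2$; 5. $F\notin\mathcal{OL}$; 6. if $\tau$ is a random variable with values in the nonnegative integers such that $P(\tau\ge2)>0$ and such that for every $\varepsilon\in(0,1)$ there is an integer $M\ge0$ with $$\sum_{k=M}^\infty p_{k+1}\overline{F^{*k}}(x)\le\varepsilon\,\overline{F^{*\tau}}(x)\qquad\text{for all }x\ge0,$$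 then $F^{*\tau}\in\mathcal L(\gamma)\setminus\mathcal{OS}$. -/

import Mathlib

open MeasureTheory Filter Topology Asymptotics Set

namespace ConvRoots

noncomputable section

/-- The tail `1 - F(x) = F((x, ∞))` of a distribution on the real line, as a real number. -/
def tail (F : Measure ℝ) (x : ℝ) : ℝ := F.real (Ioi x)

/-- The `k`-fold convolution power of `F`; the power of order `0` is the unit mass at `0`. -/
def convPow (F : Measure ℝ) : ℕ → Measure ℝ
  | 0 => Measure.dirac 0
  | k + 1 => (convPow F k).conv F

/-- The random convolution `∑ₖ pₖ F^{*k}`, where `pₖ = τ k` is the law of a random variable with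
values in the nonnegative integers. -/
def randomConv (F : Measure ℝ) (τ : PMF ℕ) : Measure ℝ :=
  Measure.sum fun k => τ k • convPow F k

/-- The class `L(γ)`: for every `t`, the tail at `x - t` is equivalent to `e^{γ t}` times the tail
at `x`, as `x → ∞` (for non-lattice distributions). -/
def classL (γ : ℝ) : Set (Measure ℝ) :=
  {F | ∀ t : ℝ, Tendsto (fun x => tail F (x - t) / tail F x) atTop (𝓝 (Real.exp (γ * t)))}

/-- The class `OL` of generalized long-tailed distributions. The quotients are taken in `[0, ∞]`. -/
def classOL : Set (Measure ℝ) :=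
  {F | ∀ t : ℝ, t ≠ 0 → limsup (fun x => F (Ioi (x - t)) / F (Ioi x)) atTop < ⊤}

/-- The class `OS` of generalized subexponential distributions. The quotients are taken in
`[0, ∞]`. -/
def classOS : Set (Measure ℝ) :=
  {F | limsup (fun x => convPow F 2 (Ioi x) / F (Ioi x)) atTop < ⊤}

/-- The exponential moment `m(F) = ∫₀^∞ e^{γ y} F(dy)`, with values in `[0, ∞]`. -/
def expMoment (γ : ℝ) (F : Measure ℝ) : ENNReal :=
  ∫⁻ y in Ici 0, ENNReal.ofReal (Real.exp (γ * y)) ∂F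

/-- `liminf F̄(x - t) / F̄(x) ≥ e^{γ t}` for all `t > 0`. -/
def LiminfCondition (γ : ℝ) (F : Measure ℝ) : Prop :=
  ∀ t : ℝ, 0 < t →
    ENNReal.ofReal (Real.exp (γ * t)) ≤ liminf (fun x => F (Ioi (x - t)) / F (Ioi x)) atTop

/-- The tail of `F` is negligible with respect to the tail of `F^{*2}`. -/
def LittleOCondition (F : Measure ℝ) : Prop :=
  tail F =o[atTop] tail (convPow F 2)

/-- For every `0 < ε < 1` there is `M` with
`∑_{k ≥ M} p_{k+1} F̄^{*k}(x) ≤ ε F̄^{*τ}(x)` for all `x ≥ 0`. -/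
def RandomCondition (F : Measure ℝ) (τ : PMF ℕ) : Prop :=
  ∀ ε : ℝ, 0 < ε → ε < 1 → ∃ M : ℕ, ∀ x : ℝ, 0 ≤ x →
    ∑' j : ℕ, τ (M + j + 1) * convPow F (M + j) (Ioi x)
      ≤ ENNReal.ofReal ε * randomConv F τ (Ioi x)

/-- The sequence `aₙ = a^(rⁿ)` with `r = 1 + 1/α`. -/
def aSeq (α a : ℝ) (n : ℕ) : ℝ := a ^ ((1 + 1 / α) ^ n)

/-- The law of `η`: `P(η = aₙ) = C aₙ^(-α)` with the normalising constant
`C = (∑ₙ aₙ^(-α))⁻¹`. -/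
def etaLaw (α a : ℝ) : Measure ℝ :=
  Measure.sum fun n : ℕ =>
    ENNReal.ofReal ((∑' i : ℕ, aSeq α a i ^ (-α))⁻¹ * aSeq α a n ^ (-α)) •
      Measure.dirac (aSeq α a n)

/-- The uniform law on the interval `(0, 1)`. -/
def uniformLaw : Measure ℝ := volume.restrict (Ioo 0 1)

/-- The law of `ξ = η^{1/s} (1 + U)^{1/s}`, with `η` and `U` independent and `U` uniformly
distributed on `(0, 1)`. -/
def xiLaw (s α a : ℝ) : Measure ℝ :=
  ((etaLaw α a).prod uniformLaw).map fun p => p.1 ^ (1 / s) * (1 + p.2) ^ (1 / s)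

/-- The class `F₂(0)` of heavy-tailed distributions: the laws `xiLaw s α a` for all admissible
parameters. -/
def classF2Zero : Set (Measure ℝ) :=
  {F₀ | ∃ s α a : ℝ, 1 < s ∧ s < 2 ∧ 1 - 1 / s < α ∧ α < 1 / s ∧ 1 < a ∧
    (2 : ℝ) ^ (s + 2) * a < a ^ (1 + 1 / α) ∧ F₀ = xiLaw s α a}

/-- `F` is the transform of `F₀` with parameter `γ`: the distribution with tail `1` on `(-∞, 0)`
and `e^{-γ x} F̄₀(x)` on `[0, ∞)`. -/
def IsTransform (γ : ℝ) (F₀ F : Measure ℝ) : Prop :=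
  IsProbabilityMeasure F ∧
    ∀ x : ℝ, tail F x = if x < 0 then 1 else Real.exp (-γ * x) * tail F₀ x

/-- The class `F₂(γ)` of transforms of the distributions in `F₂(0)`. -/
def classF2 (γ : ℝ) : Set (Measure ℝ) :=
  {F | ∃ F₀ ∈ classF2Zero, IsTransform γ F₀ F}

end

end ConvRoots

/-! Write `μ` for the law `F₀`, `S` for the tail of `μ * μ`, and `H` for `tailConv μ`, i.e. `H(x) =
∫₀ˣ μ̄(y) μ̄(x - y) dy`. Integration by parts splits `F` into `e^{-γy} μ(dy)` plus the density `γ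
e^{-γy} μ̄(y)`, and hence `F̄^{*2}(x) = e^{-γx} (S(x) + γ H(x))` for `x ≥ 0`
(`IsTransform.conv_apply_Ioi`). Everything about `F^{*2}` thus reduces to comparing `μ̄`, `S` and
`H`.

The mean of `μ` is infinite, so `μ̄ = o(H)`; this gives `F̄ = o(F̄^{*2})` and `m(F) = ∞`. The heart
of the matter is `S = o(H)` (`IsBlockMixture.negligible_conv`): `μ` is spread over long blocks, on
which its density is small compared with its tail except near the right ends, and the contribution
of these ends is absorbed by the part of `H` around the block and the gap after it. Since a shift by
`t` changes `H` by at most `|t|` times a value of `S`, `H` is long-tailed, and therefore `F^{*2}` is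
regular with exponent `γ`.

Regularity passes from `F^{*2}` to all higher powers with constants uniform in the order
(`exists_convPow_shift_le`); the errors are tails of powers of one order less, which sum to a
negligible quantity by the condition on `τ` and by `F̄^{*k} = o(F̄^{*(k+1)})`. Fixed powers are the
case of constant `τ`. Infinite exponential moments exclude `OS` by Fatou's lemma. Finally `F ∉ OL`
because `μ̄` collapses within distance one of the right end of a block. -/

namespace ConvRoots

open scoped ENNReal

/-! ### Negligible functions with values in `[0, ∞]` -/

/-- `f = o(h)` for functions with values in `[0, ∞]`. -/
def Negligible (f h : ℝ → ℝ≥0∞) : Prop :=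
  ∀ ε : ℝ≥0∞, ε ≠ 0 → ∀ᶠ x in atTop, f x ≤ ε * h x

lemma exists_pos_ofReal_le {ε : ℝ≥0∞} (hε : ε ≠ 0) :
    ∃ δ : ℝ, 0 < δ ∧ δ < 1 ∧ ENNReal.ofReal δ ≤ ε := by
  by_cases h : 1 / 2 ≤ ε
  · refine ⟨1 / 2, by norm_num, by norm_num, le_trans ?_ h⟩
    rw [ENNReal.ofReal_div_of_pos two_pos]
    simp
  · have h' := not_le.1 h
    refine ⟨ε.toReal, ENNReal.toReal_pos hε h'.ne_top, ?_, ENNReal.ofReal_toReal_le⟩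
    rw [← ENNReal.toReal_one]
    refine (ENNReal.toReal_lt_toReal h'.ne_top ENNReal.one_ne_top).2 (h'.trans_le ?_)
    simp

namespace Negligible

variable {f f' h h' : ℝ → ℝ≥0∞}

lemma mono_left (hf : Negligible f h) (hle : ∀ᶠ x in atTop, f' x ≤ f x) : Negligible f' h :=
  fun ε hε => by
    filter_upwards [hf ε hε, hle] with x h1 h2 using h2.trans h1

lemma mono_right (hf : Negligible f h) {c : ℝ≥0∞} (hc : c ≠ ⊤)
    (hle : ∀ᶠ x in atTop, h x ≤ c * h' x) : Negligible f h' := fun ε hε => by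
  -- If `c = 0`, then `ε / c = ⊤`, which `Negligible` admits as a tolerance.
  filter_upwards [hf (ε / c) (ENNReal.div_ne_zero.2 ⟨hε, hc⟩), hle] with x h1 h2
  calc f x ≤ ε / c * h x := h1
    _ ≤ ε / c * (c * h' x) := by gcongr
    _ = c * (ε / c) * h' x := by ring
    _ ≤ ε * h' x := by gcongr; exact ENNReal.mul_div_le

lemma const_mul (hf : Negligible f h) {c : ℝ≥0∞} (hc : c ≠ ⊤) :
    Negligible (fun x => c * f x) h := fun ε hε => by
  filter_upwards [hf (ε / c) (ENNReal.div_ne_zero.2 ⟨hε, hc⟩)] with x h1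
  calc c * f x ≤ c * (ε / c * h x) := by gcongr
    _ = c * (ε / c) * h x := by ring
    _ ≤ ε * h x := by gcongr; exact ENNReal.mul_div_le

lemma add (hf : Negligible f h) (hf' : Negligible f' h) :
    Negligible (fun x => f x + f' x) h := fun ε hε => by
  have hε2 : ε / 2 ≠ 0 := ENNReal.div_ne_zero.2 ⟨hε, by simp⟩
  filter_upwards [hf _ hε2, hf' _ hε2] with x h1 h2
  calc f x + f' x ≤ ε / 2 * h x + ε / 2 * h x := add_le_add h1 h2
    _ = ε * h x := by rw [← add_mul, ENNReal.add_halves]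

lemma comp_sub (hf : Negligible f h) (c : ℝ) :
    Negligible (fun x => f (x - c)) (fun x => h (x - c)) := fun ε hε =>
  (tendsto_atTop_add_const_right atTop (-c) tendsto_id).eventually (hf ε hε)

lemma zero_left (hf : ∀ᶠ x in atTop, f x = 0) : Negligible f h := fun ε _ => by
  filter_upwards [hf] with x hx
  simp [hx]

end Negligible

/-- The one-sided form of membership in `L(γ)`, for tails with values in `[0, ∞]`. -/
def TailRegular (γ : ℝ) (T : ℝ → ℝ≥0∞) : Prop :=
  ∀ t c : ℝ, Real.exp (γ * t) < c → ∀ᶠ x in atTop, T (x - t) ≤ ENNReal.ofReal c * T x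

lemma TailRegular.eventually_le {γ : ℝ} {T : ℝ → ℝ≥0∞} (hT : TailRegular γ T) (t : ℝ) :
    ∀ᶠ x in atTop, T (x - t) ≤ ENNReal.ofReal (Real.exp (γ * t) + 1) * T x :=
  hT t _ (by linarith)

/-- If `f = o(T)` and `T` is regular, then every shift of `f` is negligible as well. -/
lemma TailRegular.negligible_shift {γ : ℝ} {f T : ℝ → ℝ≥0∞} (hT : TailRegular γ T)
    (hf : Negligible f T) (c : ℝ) : Negligible (fun x => f (x - c)) T :=
  (hf.comp_sub c).mono_right ENNReal.ofReal_ne_top (hT.eventually_le c)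

/-- Upper bounds for all real `t` suffice: the bound for `-t`, read at the shifted point `x - t`, is
the lower bound for `t`. -/
lemma tailRegular_mem_classL {γ : ℝ} {G : Measure ℝ} [IsFiniteMeasure G]
    (hpos : ∀ x, G (Ioi x) ≠ 0) (hG : TailRegular γ fun x => G (Ioi x)) : G ∈ classL γ := by
  have htpos : ∀ x, 0 < tail G x := fun x =>
    ENNReal.toReal_pos (hpos x) (measure_ne_top _ _)
  have key : ∀ t c : ℝ, Real.exp (γ * t) < c →
      ∀ᶠ x in atTop, tail G (x - t) ≤ c * tail G x := by
    intro t c hc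
    have hc0 : 0 ≤ c := (Real.exp_pos _).le.trans hc.le
    filter_upwards [hG t c hc] with x hx
    have := ENNReal.toReal_mono (ENNReal.mul_ne_top ENNReal.ofReal_ne_top (measure_ne_top _ _)) hx
    rwa [ENNReal.toReal_mul, ENNReal.toReal_ofReal hc0] at this
  intro t
  rw [tendsto_order]
  constructor
  · intro c hc
    rcases le_or_gt c 0 with h0 | h0
    · exact Eventually.of_forall fun x => h0.trans_lt (div_pos (htpos _) (htpos _))
    obtain ⟨d, hd1, hd2⟩ := exists_between hc
    have hd0 : 0 < d := h0.trans hd1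
    have h1 : Real.exp (γ * -t) < d⁻¹ := by
      rw [mul_neg, Real.exp_neg]
      exact inv_strictAnti₀ hd0 hd2
    have h2 := (tendsto_atTop_add_const_right atTop (-t) tendsto_id).eventually (key (-t) _ h1)
    filter_upwards [h2] with x hx
    simp only [id_eq, sub_neg_eq_add, ← sub_eq_add_neg, sub_add_cancel] at hx
    rw [lt_div_iff₀ (htpos x)]
    rw [← div_eq_inv_mul, le_div_iff₀ hd0] at hx
    nlinarith [htpos x]
  · intro c hc
    obtain ⟨d, hd1, hd2⟩ := exists_between hc
    filter_upwards [key t d hd1] with x hx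
    rw [div_lt_iff₀ (htpos x)]
    nlinarith [htpos x]

/-! ### Convolution powers -/

instance convPow_isProbabilityMeasure (F : Measure ℝ) [IsProbabilityMeasure F] (k : ℕ) :
    IsProbabilityMeasure (convPow F k) := by
  induction k with
  | zero => exact Measure.dirac.isProbabilityMeasure
  | succ k ih =>
    rw [convPow]
    infer_instance

lemma conv_apply_Ioi (μ ν : Measure ℝ) [SFinite μ] [SFinite ν] (x : ℝ) :
    (μ.conv ν) (Ioi x) = ∫⁻ y, μ (Ioi (x - y)) ∂ν := by
  rw [Measure.conv_comm, ← lintegral_indicator_one measurableSet_Ioi,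
    Measure.lintegral_conv (measurable_one.indicator measurableSet_Ioi)]
  congr 1 with y
  rw [← lintegral_indicator_one measurableSet_Ioi]
  congr 1 with z
  simp [indicator, sub_lt_iff_lt_add']

lemma measurable_measure_Ioi (μ : Measure ℝ) : Measurable fun x => μ (Ioi x) :=
  Antitone.measurable fun _ _ h => measure_mono (Ioi_subset_Ioi h)

lemma measurable_measure_Ioi_sub (μ : Measure ℝ) (x : ℝ) : Measurable fun y => μ (Ioi (x - y)) :=
  (measurable_measure_Ioi μ).comp (measurable_const.sub measurable_id)

section Powers

variable (F : Measure ℝ) [IsProbabilityMeasure F]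

lemma convPow_one : convPow F 1 = F := by
  simp [convPow]

lemma convPow_two : convPow F 2 = F.conv F := by
  rw [convPow, convPow_one]

lemma convPow_add (m n : ℕ) : convPow F (m + n) = (convPow F m).conv (convPow F n) := by
  induction n with
  | zero => simp [convPow]
  | succ n ih => rw [← add_assoc, convPow, ih, convPow, Measure.conv_assoc]

variable {F}

lemma convPow_succ_Ioi_ge (hF : F (Iio 0) = 0) (k : ℕ) (x : ℝ) :
    convPow F k (Ioi x) ≤ convPow F (k + 1) (Ioi x) := by
  rw [convPow, conv_apply_Ioi]
  calc convPow F k (Ioi x) = ∫⁻ _, convPow F k (Ioi x) ∂F := by simp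
    _ ≤ ∫⁻ y, convPow F k (Ioi (x - y)) ∂F := by
      refine lintegral_mono_ae ?_
      have : ∀ᵐ y ∂F, 0 ≤ y := by
        rw [ae_iff]
        simp only [not_le]
        exact hF
      filter_upwards [this] with y hy
      exact measure_mono (Ioi_subset_Ioi (by linarith))

lemma convPow_Ioi_mono (hF : F (Iio 0) = 0) (x : ℝ) :
    Monotone fun k => convPow F k (Ioi x) :=
  monotone_nat_of_le_succ fun k => convPow_succ_Ioi_ge hF k x

lemma convPow_Ioi_ne_zero (hF : F (Iio 0) = 0) (hpos : ∀ x, F (Ioi x) ≠ 0) {k : ℕ} (hk : 1 ≤ k)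
    (x : ℝ) : convPow F k (Ioi x) ≠ 0 := by
  have h := convPow_Ioi_mono hF x hk
  simp only [convPow_one] at h
  exact ((hpos x).bot_lt.trans_le h).ne'

lemma mul_convPow_le_convPow_succ (k : ℕ) (x x₀ : ℝ) :
    F (Ioi x₀) * convPow F k (Ioi (x - x₀)) ≤ convPow F (k + 1) (Ioi x) := by
  rw [add_comm, convPow_add, convPow_one, conv_apply_Ioi]
  calc F (Ioi x₀) * convPow F k (Ioi (x - x₀))
      = ∫⁻ _ in Ioi (x - x₀), F (Ioi x₀) ∂convPow F k := by simp
    _ ≤ ∫⁻ y in Ioi (x - x₀), F (Ioi (x - y)) ∂convPow F k := by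
      refine setLIntegral_mono' measurableSet_Ioi fun y hy => ?_
      rw [mem_Ioi] at hy
      exact measure_mono (Ioi_subset_Ioi (by linarith))
    _ ≤ _ := setLIntegral_le_lintegral _ _

/-- The shift of the tails of all convolution powers is controlled uniformly in the order. -/
lemma exists_convPow_shift_le {γ : ℝ} (hpos : ∀ x, F (Ioi x) ≠ 0)
    (hL : TailRegular γ fun x => convPow F 2 (Ioi x)) {t c : ℝ} (hc : Real.exp (γ * t) < c) :
    ∃ C : ℝ≥0∞, C ≠ ⊤ ∧ ∀ (k : ℕ) (x : ℝ), convPow F (k + 2) (Ioi (x - t)) ≤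
      ENNReal.ofReal c * convPow F (k + 2) (Ioi x) + C * convPow F (k + 1) (Ioi x) := by
  obtain ⟨x₀, hx₀⟩ := eventually_atTop.1 (hL t c hc)
  -- Write `F^{*(k+2)}` as `F^{*2} * F^{*k}`. Where the `F^{*k}`-variable is at most `x - x₀`,
  -- regularity of `F^{*2}` applies; the rest has mass at most `F̄^{*k}(x - x₀)`, and one further
  -- summand exceeding `x₀` turns this into a multiple of `F̄^{*(k+1)}(x)`. The threshold `x₀`
  -- depends only on `F^{*2}`, whence the uniformity in `k`.
  refine ⟨(F (Ioi x₀))⁻¹, ENNReal.inv_ne_top.2 (hpos x₀), fun k x => ?_⟩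
  have hlast : convPow F k (Ioi (x - x₀)) ≤ (F (Ioi x₀))⁻¹ * convPow F (k + 1) (Ioi x) := by
    rw [← ENNReal.div_eq_inv_mul, ENNReal.le_div_iff_mul_le (Or.inl (hpos _))
      (Or.inl (measure_ne_top _ _)), mul_comm]
    exact mul_convPow_le_convPow_succ k x x₀
  refine le_trans ?_ (add_le_add_right hlast _)
  rw [add_comm k 2, convPow_add, conv_apply_Ioi, conv_apply_Ioi,
    ← lintegral_const_mul _ (measurable_measure_Ioi_sub _ _),
    ← lintegral_add_compl _ (measurableSet_Iic (a := x - x₀)), compl_Iic]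
  refine add_le_add ?_ ?_
  · refine le_trans ?_ (setLIntegral_le_lintegral (Iic (x - x₀)) _)
    refine setLIntegral_mono' measurableSet_Iic fun y hy => ?_
    rw [mem_Iic] at hy
    have := hx₀ (x - y) (by linarith)
    rwa [show x - y - t = x - t - y by ring] at this
  · calc ∫⁻ y in Ioi (x - x₀), convPow F 2 (Ioi (x - t - y)) ∂convPow F k
        ≤ ∫⁻ _ in Ioi (x - x₀), 1 ∂convPow F k := lintegral_mono fun y => prob_le_one
      _ = _ := by simp

/-- Induction by conditioning on the last summand `y`: for `y ≤ x - x₀` the previous order applies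
under the integral, and the remaining mass `F̄(x - x₀)` is a shift of a function that is
`o(F̄^{*2})`. -/
lemma negligible_convPow_succ {γ : ℝ} (hF : F (Iio 0) = 0)
    (hL : TailRegular γ fun x => convPow F 2 (Ioi x))
    (hN : Negligible (fun x => F (Ioi x)) fun x => convPow F 2 (Ioi x)) (k : ℕ) :
    Negligible (fun x => convPow F k (Ioi x)) fun x => convPow F (k + 1) (Ioi x) := by
  induction k with
  | zero =>
    refine Negligible.zero_left ?_
    filter_upwards [eventually_ge_atTop 0] with x hx
    simp [convPow, hx]
  | succ k ih =>
    rcases Nat.eq_zero_or_pos k with rfl | hk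
    · simpa only [convPow_one, zero_add] using hN
    have hshift : ∀ c, Negligible (fun x => F (Ioi (x - c)))
        fun x => convPow F (k + 1 + 1) (Ioi x) := fun c =>
      (hL.negligible_shift hN c).mono_right ENNReal.one_ne_top <| Eventually.of_forall fun x => by
        rw [one_mul]
        exact convPow_Ioi_mono hF x (by omega)
    intro ε hε
    have hε2 : ε / 2 ≠ 0 := ENNReal.div_ne_zero.2 ⟨hε, by simp⟩
    obtain ⟨x₀, hx₀⟩ := eventually_atTop.1 (ih _ hε2)
    filter_upwards [hshift x₀ _ hε2] with x hx
    calc convPow F (k + 1) (Ioi x)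
        ≤ ε / 2 * convPow F (k + 1 + 1) (Ioi x) + F (Ioi (x - x₀)) := by
          rw [convPow, conv_apply_Ioi, convPow, conv_apply_Ioi,
            ← lintegral_const_mul _ (measurable_measure_Ioi_sub _ _),
            ← lintegral_add_compl _ (measurableSet_Iic (a := x - x₀)), compl_Iic]
          refine add_le_add ?_ ?_
          · refine le_trans ?_ (setLIntegral_le_lintegral (Iic (x - x₀)) _)
            refine setLIntegral_mono' measurableSet_Iic fun y hy => ?_
            rw [mem_Iic] at hy
            exact hx₀ (x - y) (by linarith)
          · calc ∫⁻ y in Ioi (x - x₀), convPow F k (Ioi (x - y)) ∂F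
                ≤ ∫⁻ _ in Ioi (x - x₀), 1 ∂F := lintegral_mono fun y => prob_le_one
              _ = _ := by simp
      _ ≤ ε / 2 * convPow F (k + 1 + 1) (Ioi x) + ε / 2 * convPow F (k + 1 + 1) (Ioi x) := by
          gcongr
      _ = _ := by rw [← add_mul, ENNReal.add_halves]

end Powers

/-! ### Random convolution -/

section Random

variable {F : Measure ℝ} {τ : PMF ℕ}

lemma randomConv_Ioi (x : ℝ) :
    randomConv F τ (Ioi x) = ∑' k, τ k * convPow F k (Ioi x) := by
  rw [randomConv, Measure.sum_apply _ measurableSet_Ioi]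
  rfl

lemma randomConv_pure (k : ℕ) : randomConv F (PMF.pure k) = convPow F k := by
  ext A hA
  rw [randomConv, Measure.sum_apply _ hA, tsum_eq_single k]
  · simp
  · intro j hj
    simp [PMF.pure_apply, hj]

/-- With `M = k` every weight in the sum has index above `k` and vanishes. -/
lemma randomCondition_pure (k : ℕ) : RandomCondition F (PMF.pure k) := by
  intro ε _ _
  refine ⟨k, fun x _ => ?_⟩
  have : ∀ j, (PMF.pure k) (k + j + 1) = 0 := fun j => by
    rw [PMF.pure_apply, if_neg (by omega)]
  simp [this]

lemma convPow_le_randomConv {k : ℕ} (hk : τ k ≠ 0) (x : ℝ) :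
    convPow F k (Ioi x) ≤ (τ k)⁻¹ * randomConv F τ (Ioi x) := by
  rw [← ENNReal.div_eq_inv_mul, ENNReal.le_div_iff_mul_le (Or.inl hk)
      (Or.inl (τ.apply_ne_top k)), mul_comm, randomConv_Ioi]
  exact ENNReal.le_tsum k

variable [IsProbabilityMeasure F]

instance randomConv_isProbabilityMeasure : IsProbabilityMeasure (randomConv F τ) := by
  constructor
  rw [randomConv, Measure.sum_apply _ MeasurableSet.univ]
  simp [τ.tsum_coe]

/-- This is the total error produced by shifting the random convolution. The condition on `τ`
controls the orders from `M` on; the finitely many lower ones are handled by `F̄^{*k} =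
o(F̄^{*(k+1)})`, which makes the matching weight `p_{k+1}` available. -/
lemma negligible_sum_randomConv {γ : ℝ} (hF : F (Iio 0) = 0)
    (hL : TailRegular γ fun x => convPow F 2 (Ioi x))
    (hN : Negligible (fun x => F (Ioi x)) fun x => convPow F 2 (Ioi x))
    (hτ : RandomCondition F τ) :
    Negligible (fun x => ∑' k, τ (k + 1) * convPow F k (Ioi x))
      fun x => randomConv F τ (Ioi x) := by
  intro ε hε
  have hε2 : ε / 2 ≠ 0 := ENNReal.div_ne_zero.2 ⟨hε, by simp⟩
  obtain ⟨δ, hδ0, hδ1, hδ⟩ := exists_pos_ofReal_le hε2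
  obtain ⟨M, hM⟩ := hτ δ hδ0 hδ1
  have hfin : ∀ᶠ x in atTop, ∀ k ∈ Finset.range M,
      convPow F k (Ioi x) ≤ ε / 2 * convPow F (k + 1) (Ioi x) :=
    (Finset.eventually_all _).2 fun k _ => negligible_convPow_succ hF hL hN k _ hε2
  filter_upwards [hfin, eventually_ge_atTop 0] with x hx hx0
  rw [← ENNReal.summable.sum_add_tsum_nat_add' (k := M)]
  calc _ ≤ ε / 2 * randomConv F τ (Ioi x) + ε / 2 * randomConv F τ (Ioi x) := ?_
    _ = _ := by rw [← add_mul, ENNReal.add_halves]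
  refine add_le_add ?_ ?_
  · calc ∑ k ∈ Finset.range M, τ (k + 1) * convPow F k (Ioi x)
        ≤ ∑ k ∈ Finset.range M, ε / 2 * (τ (k + 1) * convPow F (k + 1) (Ioi x)) := by
          refine Finset.sum_le_sum fun k hk => ?_
          rw [mul_left_comm]
          gcongr
          exact hx k hk
      _ = ε / 2 * ∑ k ∈ Finset.range M, τ (k + 1) * convPow F (k + 1) (Ioi x) := by
          rw [Finset.mul_sum]
      _ ≤ ε / 2 * ∑' k, τ (k + 1) * convPow F (k + 1) (Ioi x) := by
          gcongr
          exact ENNReal.sum_le_tsum _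
      _ ≤ ε / 2 * randomConv F τ (Ioi x) := by
          gcongr
          rw [randomConv_Ioi]
          exact ENNReal.tsum_comp_le_tsum_of_injective (add_left_injective 1)
            fun k => τ k * convPow F k (Ioi x)
  · calc ∑' j, τ (j + M + 1) * convPow F (j + M) (Ioi x)
        = ∑' j, τ (M + j + 1) * convPow F (M + j) (Ioi x) := by simp only [add_comm M]
      _ ≤ ENNReal.ofReal δ * randomConv F τ (Ioi x) := hM x hx0
      _ ≤ _ := by gcongr

lemma tailRegular_randomConv {γ : ℝ} (hF : F (Iio 0) = 0) (hpos : ∀ x, F (Ioi x) ≠ 0)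
    (hL : TailRegular γ fun x => convPow F 2 (Ioi x))
    (hN : Negligible (fun x => F (Ioi x)) fun x => convPow F 2 (Ioi x))
    (hτ₂ : ∃ k : ℕ, 2 ≤ k ∧ 0 < τ k) (hτ : RandomCondition F τ) :
    TailRegular γ fun x => randomConv F τ (Ioi x) := by
  intro t c hc
  obtain ⟨d, hd1, hd2⟩ := exists_between hc
  have hd0 : 0 ≤ d := (Real.exp_pos _).le.trans hd1.le
  obtain ⟨C, hC, hshift⟩ := exists_convPow_shift_le hpos hL hd1
  obtain ⟨k, hk2, hk⟩ := hτ₂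
  have hle : ∀ x, convPow F 2 (Ioi x) ≤ (τ k)⁻¹ * randomConv F τ (Ioi x) := fun x =>
    (convPow_Ioi_mono hF x hk2).trans (convPow_le_randomConv hk.ne' x)
  have h0 : Negligible (fun x => convPow F 0 (Ioi (x - t))) fun x => randomConv F τ (Ioi x) := by
    refine Negligible.zero_left ?_
    filter_upwards [eventually_ge_atTop t] with x hx
    simp [convPow, hx]
  have h1 : Negligible (fun x => convPow F 1 (Ioi (x - t))) fun x => randomConv F τ (Ioi x) := by
    simp only [convPow_one]
    exact (hL.negligible_shift hN t).mono_right (ENNReal.inv_ne_top.2 hk.ne')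
      (Eventually.of_forall hle)
  have h2 := ((h0.add h1).add ((negligible_sum_randomConv hF hL hN hτ).const_mul hC))
    (ENNReal.ofReal (c - d)) (by simpa using hd2)
  filter_upwards [h2] with x hx
  -- The uniform shift bound starts at order two. Order zero vanishes for large `x`, and order one
  -- is negligible because some order `k ≥ 2` has positive weight.
  rw [randomConv_Ioi (x - t), ← ENNReal.summable.sum_add_tsum_nat_add' (k := 2)]
  simp only [Finset.sum_range_succ, Finset.sum_range_zero, zero_add]
  have hsum : ∑' j, τ (j + 2) * convPow F (j + 2) (Ioi (x - t)) ≤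
      ENNReal.ofReal d * randomConv F τ (Ioi x) +
        C * ∑' k, τ (k + 1) * convPow F k (Ioi x) := by
    calc ∑' j, τ (j + 2) * convPow F (j + 2) (Ioi (x - t))
        ≤ ∑' j, (ENNReal.ofReal d * (τ (j + 2) * convPow F (j + 2) (Ioi x)) +
            C * (τ (j + 1 + 1) * convPow F (j + 1) (Ioi x))) := by
          refine ENNReal.tsum_le_tsum fun j => ?_
          rw [mul_left_comm, mul_left_comm C, ← mul_add]
          gcongr
          exact hshift j x
      _ = ENNReal.ofReal d * ∑' j, τ (j + 2) * convPow F (j + 2) (Ioi x) +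
            C * ∑' j, τ (j + 1 + 1) * convPow F (j + 1) (Ioi x) := by
          rw [ENNReal.tsum_add, ENNReal.tsum_mul_left, ENNReal.tsum_mul_left]
      _ ≤ _ := by
          refine add_le_add (mul_le_mul_right ?_ _) (mul_le_mul_right ?_ _)
          · rw [randomConv_Ioi]
            exact ENNReal.tsum_comp_le_tsum_of_injective (add_left_injective 2)
              fun k => τ k * convPow F k (Ioi x)
          · exact ENNReal.tsum_comp_le_tsum_of_injective (add_left_injective 1)
              fun k => τ (k + 1) * convPow F k (Ioi x)
  calc _ ≤ (1 * convPow F 0 (Ioi (x - t)) + 1 * convPow F 1 (Ioi (x - t))) +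
        (ENNReal.ofReal d * randomConv F τ (Ioi x) +
        C * ∑' k, τ (k + 1) * convPow F k (Ioi x)) := by
        gcongr
        · exact τ.coe_le_one 0
        · exact τ.coe_le_one 1
    _ = ENNReal.ofReal d * randomConv F τ (Ioi x) + (convPow F 0 (Ioi (x - t)) +
        convPow F 1 (Ioi (x - t)) + C * ∑' k, τ (k + 1) * convPow F k (Ioi x)) := by ring
    _ ≤ ENNReal.ofReal d * randomConv F τ (Ioi x) +
        ENNReal.ofReal (c - d) * randomConv F τ (Ioi x) := by gcongr
    _ = _ := by
        rw [← add_mul, ← ENNReal.ofReal_add hd0 (by linarith), add_sub_cancel]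

lemma lintegral_exp_convPow {γ : ℝ} (k : ℕ) :
    ∫⁻ y, ENNReal.ofReal (Real.exp (γ * y)) ∂convPow F k =
      (∫⁻ y, ENNReal.ofReal (Real.exp (γ * y)) ∂F) ^ k := by
  have hm : Measurable fun y : ℝ => ENNReal.ofReal (Real.exp (γ * y)) := by fun_prop
  induction k with
  | zero => simp [convPow]
  | succ k ih =>
    rw [convPow, Measure.lintegral_conv hm, pow_succ, ← ih]
    simp only [mul_add, Real.exp_add, ENNReal.ofReal_mul (Real.exp_pos _).le]
    simp_rw [lintegral_const_mul _ hm]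
    rw [lintegral_mul_const _ hm]

lemma lintegral_exp_randomConv {γ : ℝ} (hm : expMoment γ F = ⊤) {k : ℕ} (hk1 : k ≠ 0)
    (hk : τ k ≠ 0) :
    ∫⁻ y, ENNReal.ofReal (Real.exp (γ * y)) ∂randomConv F τ = ⊤ := by
  have hF : ∫⁻ y, ENNReal.ofReal (Real.exp (γ * y)) ∂F = ⊤ :=
    top_unique (hm.ge.trans (setLIntegral_le_lintegral _ _))
  refine top_unique ?_
  rw [randomConv, lintegral_sum_measure]
  refine le_trans ?_ (ENNReal.le_tsum k)
  rw [lintegral_smul_measure, lintegral_exp_convPow, hF, ENNReal.top_pow hk1, smul_eq_mul,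
    ENNReal.mul_top hk]

end Random

/-- The quotient `Ḡ^{*2}(x) / Ḡ(x)` is the `G`-integral of `Ḡ(x - y) / Ḡ(x)`, whose pointwise limit
is `e^{γy}`. Fatou's lemma bounds its lower limit below by the exponential moment, which is
infinite. -/
lemma notMem_classOS {γ : ℝ} {G : Measure ℝ} [IsProbabilityMeasure G] (hpos : ∀ x, G (Ioi x) ≠ 0)
    (hG : G ∈ classL γ) (hm : ∫⁻ y, ENNReal.ofReal (Real.exp (γ * y)) ∂G = ⊤) :
    G ∉ classOS := by
  intro (hOS : limsup (fun x => convPow G 2 (Ioi x) / G (Ioi x)) atTop < ⊤)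
  refine hOS.ne (top_unique ?_)
  have hlim : ∀ y, liminf (fun x => G (Ioi (x - y)) / G (Ioi x)) atTop =
      ENNReal.ofReal (Real.exp (γ * y)) := by
    intro y
    refine Tendsto.liminf_eq ?_
    have := ENNReal.tendsto_ofReal (hG y)
    refine this.congr fun x => ?_
    have hx : 0 < G.real (Ioi x) := ENNReal.toReal_pos (hpos x) (measure_ne_top _ _)
    rw [tail, tail, ENNReal.ofReal_div_of_pos hx, ofReal_measureReal, ofReal_measureReal]
  calc ⊤ = ∫⁻ y, liminf (fun x => G (Ioi (x - y)) / G (Ioi x)) atTop ∂G := by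
        simp_rw [hlim]
        exact hm.symm
    _ ≤ liminf (fun x => ∫⁻ y, G (Ioi (x - y)) / G (Ioi x) ∂G) atTop :=
        lintegral_liminf_le fun x => (measurable_measure_Ioi_sub G x).div_const _
    _ = liminf (fun x => convPow G 2 (Ioi x) / G (Ioi x)) atTop := by
        congr 1 with x
        simp only [div_eq_mul_inv]
        rw [lintegral_mul_const _ (measurable_measure_Ioi_sub G x), convPow_two, conv_apply_Ioi]
    _ ≤ _ := liminf_le_limsup

lemma randomConv_mem_classL_diff_classOS {F : Measure ℝ} [IsProbabilityMeasure F] {τ : PMF ℕ}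
    {γ : ℝ} (hF : F (Iio 0) = 0) (hpos : ∀ x, F (Ioi x) ≠ 0)
    (hL : TailRegular γ fun x => convPow F 2 (Ioi x))
    (hN : Negligible (fun x => F (Ioi x)) fun x => convPow F 2 (Ioi x))
    (hm : expMoment γ F = ⊤)
    (hτ₂ : ∃ k : ℕ, 2 ≤ k ∧ 0 < τ k) (hτ : RandomCondition F τ) :
    randomConv F τ ∈ classL γ \ classOS := by
  have hreg := tailRegular_randomConv hF hpos hL hN hτ₂ hτ
  obtain ⟨k, hk2, hk⟩ := hτ₂
  have hpos' : ∀ x, randomConv F τ (Ioi x) ≠ 0 := fun x h => by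
    have := convPow_le_randomConv (F := F) hk.ne' x
    rw [h, mul_zero] at this
    exact convPow_Ioi_ne_zero hF hpos (by omega) x (le_antisymm this zero_le)
  have hL' := tailRegular_mem_classL hpos' hreg
  exact ⟨hL', notMem_classOS hpos' hL' (lintegral_exp_randomConv hm (by omega) hk.ne')⟩

/-! ### The convolution of a tail with itself -/

/-- The Lebesgue convolution `∫₀ˣ μ̄(y) μ̄(x - y) dy` of the tail of `μ` with itself. -/
noncomputable def tailConv (μ : Measure ℝ) (x : ℝ) : ℝ≥0∞ :=
  ∫⁻ y in Icc 0 x, μ (Ioi y) * μ (Ioi (x - y))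

section TailConv

variable {μ : Measure ℝ} [IsProbabilityMeasure μ]

lemma measurable_tail_mul_tail (μ ν : Measure ℝ) (x : ℝ) :
    Measurable fun y => μ (Ioi y) * ν (Ioi (x - y)) :=
  (measurable_measure_Ioi μ).mul (measurable_measure_Ioi_sub ν x)

lemma tail_le_conv (hμ : μ (Iio 0) = 0) (x : ℝ) : μ (Ioi x) ≤ (μ.conv μ) (Ioi x) := by
  have := convPow_succ_Ioi_ge hμ 1 x
  rwa [convPow_one, convPow_two] at this

/-- Up to `x - t` the integrand only grows when `x` is replaced by `x - t`; the remaining interval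
has length `t` and integrand at most `μ̄(x - t)`. -/
lemma tailConv_le_shift (hμ : μ (Iio 0) = 0) {t : ℝ} (ht : 0 ≤ t) (x : ℝ) :
    tailConv μ x ≤ tailConv μ (x - t) + ENNReal.ofReal t * (μ.conv μ) (Ioi (x - t)) := by
  have hsub : Icc 0 x ⊆ Icc 0 (x - t) ∪ Icc (x - t) x := fun y hy => by
    rcases le_total y (x - t) with h | h
    · exact Or.inl ⟨hy.1, h⟩
    · exact Or.inr ⟨h, hy.2⟩
  refine (lintegral_mono_set hsub).trans ((lintegral_union_le _ _ _).trans (add_le_add ?_ ?_))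
  · refine lintegral_mono fun y => ?_
    gcongr μ (Ioi y) * μ (Ioi ?_)
    linarith
  · calc ∫⁻ y in Icc (x - t) x, μ (Ioi y) * μ (Ioi (x - y))
        ≤ ∫⁻ _ in Icc (x - t) x, μ (Ioi (x - t)) := by
          refine setLIntegral_mono' measurableSet_Icc fun y hy => ?_
          calc _ ≤ μ (Ioi (x - t)) * 1 :=
                mul_le_mul' (measure_mono (Ioi_subset_Ioi hy.1)) prob_le_one
            _ = _ := mul_one _
      _ = ENNReal.ofReal t * μ (Ioi (x - t)) := by
          rw [setLIntegral_const, Real.volume_Icc, mul_comm, sub_sub_cancel]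
      _ ≤ _ := by
          exact mul_le_mul_right (tail_le_conv hμ _) _

/-- The increment `μ̄(x - t - y) - μ̄(x - y)` is the mass of `(x - t - y, x - y]`. By Fubini, a
fixed `z` is met only by `y` in an interval of length `t` starting at `x - t - z`, where `μ̄(y) ≤
μ̄(x - t - z)`; integrating over `z` gives the tail of `μ * μ` at `x - t`. -/
lemma tailConv_shift_le {t : ℝ} (ht : 0 ≤ t) (x : ℝ) :
    tailConv μ (x - t) ≤ tailConv μ x + ENNReal.ofReal t * (μ.conv μ) (Ioi (x - t)) := by
  set E : Set (ℝ × ℝ) := {q | x - t - q.1 < q.2} ∩ {q | q.2 ≤ x - q.1} with hE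
  have hEm : MeasurableSet E := by
    refine (measurableSet_lt ?_ ?_).inter (measurableSet_le ?_ ?_) <;> fun_prop
  have hsplit : ∀ y, μ (Ioi (x - t - y)) =
      μ (Ioi (x - y)) + ∫⁻ z, E.indicator (1 : ℝ × ℝ → ℝ≥0∞) (y, z) ∂μ := by
    intro y
    have h1 : (fun z => E.indicator (1 : ℝ × ℝ → ℝ≥0∞) (y, z)) =
        (Ioc (x - t - y) (x - y)).indicator 1 := by
      ext z
      simp [indicator, hE]
    rw [h1, lintegral_indicator_one measurableSet_Ioc, add_comm,
      ← measure_union (Ioc_disjoint_Ioi le_rfl) measurableSet_Ioi,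
      Ioc_union_Ioi_eq_Ioi (by linarith)]
  calc tailConv μ (x - t)
      = ∫⁻ y in Icc 0 (x - t), (μ (Ioi y) * μ (Ioi (x - y)) +
          ∫⁻ z, μ (Ioi y) * E.indicator (1 : ℝ × ℝ → ℝ≥0∞) (y, z) ∂μ) := by
        rw [tailConv]
        refine lintegral_congr fun y => ?_
        rw [hsplit, mul_add, lintegral_const_mul']
        exact measure_ne_top _ _
    _ = (∫⁻ y in Icc 0 (x - t), μ (Ioi y) * μ (Ioi (x - y))) + ∫⁻ y in Icc 0 (x - t),
          ∫⁻ z, μ (Ioi y) * E.indicator (1 : ℝ × ℝ → ℝ≥0∞) (y, z) ∂μ :=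
        lintegral_add_left (measurable_tail_mul_tail μ μ x) _
    _ ≤ _ := by
        refine add_le_add (lintegral_mono_set (Icc_subset_Icc_right (by linarith))) ?_
        rw [lintegral_lintegral_swap]
        · rw [conv_apply_Ioi, ← lintegral_const_mul _ (measurable_measure_Ioi_sub _ _)]
          refine lintegral_mono fun z => ?_
          calc ∫⁻ y in Icc 0 (x - t), μ (Ioi y) * E.indicator (1 : ℝ × ℝ → ℝ≥0∞) (y, z)
              ≤ ∫⁻ y, μ (Ioi y) * E.indicator (1 : ℝ × ℝ → ℝ≥0∞) (y, z) :=
                setLIntegral_le_lintegral _ _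
            _ ≤ ∫⁻ y, (Icc (x - t - z) (x - z)).indicator (fun _ => μ (Ioi (x - t - z))) y := by
                refine lintegral_mono fun y => ?_
                by_cases h : (y, z) ∈ E
                · have h' : x - t - y < z ∧ z ≤ x - y := h
                  have hy : y ∈ Icc (x - t - z) (x - z) := ⟨by linarith, by linarith⟩
                  simp only [indicator_of_mem h, indicator_of_mem hy, Pi.one_apply, mul_one]
                  exact measure_mono (Ioi_subset_Ioi hy.1)
                · simp [indicator_of_notMem h]
            _ = ENNReal.ofReal t * μ (Ioi (x - t - z)) := by
                rw [lintegral_indicator measurableSet_Icc, setLIntegral_const, Real.volume_Icc,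
                  mul_comm]
                congr 2
                ring
        · exact (((measurable_measure_Ioi μ).comp measurable_fst).mul
            (measurable_one.indicator hEm)).aemeasurable

/-- If the mean of `μ` is infinite, then `μ̄(x - c)` is negligible with respect to `tailConv μ`. -/
lemma negligible_tail_shift (hμ : ∫⁻ y in Ioi 0, μ (Ioi y) = ⊤) (c : ℝ) :
    Negligible (fun x => μ (Ioi (x - c))) (tailConv μ) := by
  wlog hc : 0 ≤ c generalizing c
  · refine (this 0 le_rfl).mono_left (Eventually.of_forall fun x => ?_)
    exact measure_mono (Ioi_subset_Ioi (by linarith))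
  intro ε hε
  obtain ⟨δ, hδ0, -, hδ⟩ := exists_pos_ofReal_le hε
  -- For `y ≥ c` the factor `μ̄(x - y)` is at least `μ̄(x - c)`; the factor in front tends to
  -- infinity with the truncated mean.
  have hlow : ∀ x, (∫⁻ y in Ioc c x, μ (Ioi y)) * μ (Ioi (x - c)) ≤ tailConv μ x := by
    intro x
    rw [← lintegral_mul_const _ (measurable_measure_Ioi μ), tailConv]
    calc ∫⁻ y in Ioc c x, μ (Ioi y) * μ (Ioi (x - c))
        ≤ ∫⁻ y in Ioc c x, μ (Ioi y) * μ (Ioi (x - y)) := by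
          refine setLIntegral_mono' measurableSet_Ioc fun y hy => ?_
          gcongr μ (Ioi y) * μ (Ioi ?_)
          linarith [hy.1]
      _ ≤ _ := lintegral_mono_set fun y (hy : y ∈ Ioc c x) =>
          (⟨hc.trans hy.1.le, hy.2⟩ : y ∈ Icc 0 x)
  have htop : ∫⁻ y in Ioi c, μ (Ioi y) = ⊤ := by
    by_contra h
    have h1 : ∫⁻ y in Ioc 0 c, μ (Ioi y) ≠ ⊤ := by
      refine ((lintegral_mono (g := fun _ => 1) fun y => prob_le_one).trans_lt ?_).ne
      simp
    rw [← Ioc_union_Ioi_eq_Ioi hc] at hμ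
    exact ((lintegral_union_le _ _ _).trans_lt (ENNReal.add_lt_top.2
      ⟨h1.lt_top, Ne.lt_top h⟩)).ne hμ
  have hlim : Tendsto (fun x => ∫⁻ y in Ioc c x, μ (Ioi y)) atTop (𝓝 ⊤) := by
    have h := (aecover_Iic (μ := volume.restrict (Ioi c)) (tendsto_id (α := ℝ)
      (x := atTop))).lintegral_tendsto_of_countably_generated
      (measurable_measure_Ioi μ).aemeasurable
    simp only [id_eq, Measure.restrict_restrict measurableSet_Iic, Iic_inter_Ioi] at h
    rwa [htop] at h
  have hev : ∀ᶠ x in atTop, ENNReal.ofReal δ⁻¹ ≤ ∫⁻ y in Ioc c x, μ (Ioi y) :=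
    hlim.eventually_const_le ENNReal.ofReal_lt_top
  filter_upwards [hev] with x hx
  calc μ (Ioi (x - c)) = ENNReal.ofReal δ * (ENNReal.ofReal δ⁻¹ * μ (Ioi (x - c))) := by
        rw [← mul_assoc, ← ENNReal.ofReal_mul hδ0.le, mul_inv_cancel₀ hδ0.ne']
        simp
    _ ≤ ε * tailConv μ x := by
        gcongr
        exact le_trans (by gcongr) (hlow x)

end TailConv

/-! ### Mixtures of laws on well-separated blocks -/

/-- A probability measure `μ = ∑ₙ pₙ νₙ` whose `n`-th component is comparable to the uniform law on
a block `[bₙ, eₙ]`; the blocks are separated, and the weights satisfy `pₙ₊₁ = pₙ bₙ^{-s}`. -/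
structure IsBlockMixture (s K : ℝ) (μ : Measure ℝ) (p b e : ℕ → ℝ) (ν : ℕ → Measure ℝ) :
    Prop where
  one_lt : 1 < s
  lt_two : s < 2
  one_le : 1 ≤ K
  isProbabilityMeasure : IsProbabilityMeasure μ
  isProbabilityMeasure_block : ∀ n, IsProbabilityMeasure (ν n)
  eq_sum : μ = Measure.sum fun n => ENNReal.ofReal (p n) • ν n
  weight_pos : ∀ n, 0 < p n
  left_pos : ∀ n, 0 < b n
  weight_succ : ∀ n, p (n + 1) = p n * b n ^ (-s)
  left_le_right : ∀ n, 5 / 4 * b n ≤ e n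
  right_le_left : ∀ n, e n ≤ 2 * b n
  right_le_left_succ : ∀ n, 2 * e n ≤ b (n + 1)
  tendsto_left : Tendsto b atTop atTop
  tendsto_weight_mul_left : Tendsto (fun n => p n * b n) atTop atTop
  block_le_volume : ∀ n,
    ν n ≤ ENNReal.ofReal (4 / b n) • volume.restrict (Icc (b n) (e n))
  le_block_Ioi : ∀ n, ∀ z ∈ Icc (b n) (e n), ENNReal.ofReal ((e n - z) / b n) ≤ ν n (Ioi z)
  sum_weight_le : ∀ n, ∑' k, ENNReal.ofReal (p (k + n)) ≤ ENNReal.ofReal (K * p n)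

namespace IsBlockMixture

variable {s K : ℝ} {μ : Measure ℝ} {p b e : ℕ → ℝ} {ν : ℕ → Measure ℝ}

section

variable (h : IsBlockMixture s K μ p b e ν)
include h

lemma left_lt_right (n : ℕ) : b n < e n := by
  linarith [h.left_pos n, h.left_le_right n]

lemma right_pos (n : ℕ) : 0 < e n := (h.left_pos n).trans (h.left_lt_right n)

lemma right_lt_left_succ (n : ℕ) : e n < b (n + 1) := by
  linarith [h.right_pos n, h.right_le_left_succ n]

lemma strictMono_left : StrictMono b :=
  strictMono_nat_of_lt_succ fun n => (h.left_lt_right n).trans (h.right_lt_left_succ n)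

lemma strictMono_right : StrictMono e :=
  strictMono_nat_of_lt_succ fun n =>
    (h.right_lt_left_succ n).trans (h.left_lt_right (n + 1))

lemma block_compl (n : ℕ) : ν n (Icc (b n) (e n))ᶜ = 0 := by
  refine le_antisymm ((h.block_le_volume n _).trans ?_) zero_le
  simp [Measure.restrict_apply measurableSet_Icc.compl]

lemma block_Ioi_of_lt {n : ℕ} {z : ℝ} (hz : z < b n) : ν n (Ioi z) = 1 := by
  have := h.isProbabilityMeasure_block n
  refine (prob_compl_eq_zero_iff measurableSet_Ioi).1 (measure_mono_null ?_ (h.block_compl n))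
  exact compl_subset_compl.2 fun y hy => hz.trans_le hy.1

lemma block_Ioi_of_ge {n : ℕ} {z : ℝ} (hz : e n ≤ z) : ν n (Ioi z) = 0 := by
  refine measure_mono_null (subset_compl_iff_disjoint_right.2 ?_) (h.block_compl n)
  exact Set.disjoint_left.2 fun y hy hy' => absurd (hz.trans_lt hy) (not_lt.2 hy'.2)

lemma tail_eq (z : ℝ) : μ (Ioi z) = ∑' n, ENNReal.ofReal (p n) * ν n (Ioi z) := by
  rw [h.eq_sum, Measure.sum_apply _ measurableSet_Ioi]
  rfl

lemma weight_le_tail {n : ℕ} {z : ℝ} (hz : z < b n) : ENNReal.ofReal (p n) ≤ μ (Ioi z) := by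
  rw [h.tail_eq]
  refine le_trans ?_ (ENNReal.le_tsum n)
  rw [h.block_Ioi_of_lt hz, mul_one]

lemma block_le_tail (n : ℕ) (z : ℝ) : ENNReal.ofReal (p n) * ν n (Ioi z) ≤ μ (Ioi z) := by
  rw [h.tail_eq]
  exact ENNReal.le_tsum n

lemma le_tail_of_mem {n : ℕ} {z : ℝ} (hz : z ∈ Icc (b n) (e n)) :
    ENNReal.ofReal (p n * ((e n - z) / b n)) ≤ μ (Ioi z) := by
  refine le_trans ?_ (h.block_le_tail n z)
  rw [ENNReal.ofReal_mul (h.weight_pos n).le]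
  gcongr
  exact h.le_block_Ioi n z hz

lemma tail_le_sum {n : ℕ} {z : ℝ} (hz : ∀ k < n, e k ≤ z) :
    μ (Ioi z) ≤ ∑' k, ENNReal.ofReal (p (k + n)) := by
  rw [h.tail_eq, ← ENNReal.summable.sum_add_tsum_nat_add' (k := n),
    Finset.sum_eq_zero, zero_add]
  · refine ENNReal.tsum_le_tsum fun k => ?_
    have := h.isProbabilityMeasure_block (k + n)
    exact (mul_le_mul_right prob_le_one _).trans (mul_one _).le
  · intro k hk
    rw [h.block_Ioi_of_ge (hz k (Finset.mem_range.1 hk)), mul_zero]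

lemma tail_le {n : ℕ} {z : ℝ} (hz : ∀ k < n, e k ≤ z) :
    μ (Ioi z) ≤ ENNReal.ofReal (K * p n) :=
  (h.tail_le_sum hz).trans (h.sum_weight_le n)

lemma tail_ne_zero (z : ℝ) : μ (Ioi z) ≠ 0 := by
  obtain ⟨n, hn⟩ := (h.tendsto_left.eventually_gt_atTop z).exists
  exact ((ENNReal.ofReal_pos.2 (h.weight_pos n)).trans_le (h.weight_le_tail hn)).ne'

lemma measure_Iic_zero : μ (Iic 0) = 0 := by
  rw [h.eq_sum, Measure.sum_apply _ measurableSet_Iic]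
  refine ENNReal.tsum_eq_zero.2 fun n => ?_
  rw [Measure.smul_apply, smul_eq_mul]
  have : ν n (Iic 0) = 0 := measure_mono_null
    (subset_compl_iff_disjoint_right.2 (Set.disjoint_left.2 fun y hy hy' =>
      absurd ((h.left_pos n).trans_le hy'.1) (not_lt.2 hy))) (h.block_compl n)
  rw [this, mul_zero]

/-- The tail is at least `pₙ` on `(0, bₙ)`, and `pₙ bₙ → ∞`. -/
lemma lintegral_tail : ∫⁻ y in Ioi 0, μ (Ioi y) = ⊤ := by
  refine ENNReal.eq_top_of_forall_nnreal_le fun r => ?_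
  obtain ⟨n, hn⟩ := (h.tendsto_weight_mul_left.eventually_ge_atTop (r : ℝ)).exists
  calc (r : ℝ≥0∞) = ENNReal.ofReal r := by simp
    _ ≤ ENNReal.ofReal (p n * b n) := ENNReal.ofReal_le_ofReal hn
    _ = ∫⁻ _ in Ioo 0 (b n), ENNReal.ofReal (p n) := by
        rw [setLIntegral_const, Real.volume_Ioo, sub_zero,
          ENNReal.ofReal_mul (h.weight_pos n).le]
    _ ≤ ∫⁻ y in Ioo 0 (b n), μ (Ioi y) :=
        setLIntegral_mono' measurableSet_Ioo fun y hy => h.weight_le_tail hy.2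
    _ ≤ _ := lintegral_mono_set Ioo_subset_Ioi_self

/-- The tail decreases at most polynomially under doubling of the argument. -/
lemma tail_le_tail_two_mul {y : ℝ} (hy : 1 ≤ y) :
    ENNReal.ofReal ((4 * K)⁻¹ * y ^ (-s)) * μ (Ioi y) ≤ μ (Ioi (2 * y)) := by
  have hK : 0 < K := one_pos.trans_le h.one_le
  have hs : 0 < s := one_pos.trans h.one_lt
  have hex : ∃ n, y < e n := by
    obtain ⟨n, hn⟩ := (h.tendsto_left.eventually_gt_atTop y).exists
    exact ⟨n, hn.trans (h.left_lt_right n)⟩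
  classical
  obtain ⟨n, hn, hmin⟩ : ∃ n, y < e n ∧ ∀ k < n, e k ≤ y :=
    ⟨Nat.find hex, Nat.find_spec hex, fun k hk => not_lt.1 (Nat.find_min hex hk)⟩
  -- Here `n` is the first block not entirely to the left of `y`. If `2y` has not reached it, all
  -- the mass of the blocks from `n` on lies beyond `2y`. Otherwise `y ≥ bₙ / 2`, and the loss is at
  -- most the ratio `bₙ^{-s}` of consecutive weights up to constants, comparable to `y^{-s}`.
  rcases lt_or_ge (2 * y) (b n) with h2 | h2
  · have h1 : ENNReal.ofReal ((4 * K)⁻¹ * y ^ (-s)) ≤ 1 := by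
      rw [ENNReal.ofReal_le_one]
      refine mul_le_one₀ (inv_le_one_of_one_le₀ (by linarith [h.one_le]))
        (Real.rpow_nonneg (by linarith) _) ?_
      exact Real.rpow_le_one_of_one_le_of_nonpos hy (by linarith)
    calc _ ≤ 1 * μ (Ioi y) := by gcongr
      _ ≤ ∑' k, ENNReal.ofReal (p (k + n)) := by
          rw [one_mul]
          exact h.tail_le_sum hmin
      _ = ∑' k, ENNReal.ofReal (p (k + n)) * ν (k + n) (Ioi (2 * y)) := by
          refine tsum_congr fun k => ?_
          rw [h.block_Ioi_of_lt (h2.trans_le (h.strictMono_left.monotone (Nat.le_add_left _ _))),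
            mul_one]
      _ ≤ μ (Ioi (2 * y)) := by
          rw [h.tail_eq]
          exact ENNReal.tsum_comp_le_tsum_of_injective (add_left_injective n)
            fun k => ENNReal.ofReal (p k) * ν k (Ioi (2 * y))
  · have hlt : 2 * y < b (n + 1) := by linarith [h.right_le_left_succ n]
    have hb := h.left_pos n
    refine le_trans ?_ (h.weight_le_tail hlt)
    calc _ ≤ ENNReal.ofReal ((4 * K)⁻¹ * y ^ (-s)) * ENNReal.ofReal (K * p n) := by
          gcongr
          exact h.tail_le hmin
      _ = ENNReal.ofReal ((4 * K)⁻¹ * y ^ (-s) * (K * p n)) :=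
          (ENNReal.ofReal_mul (by positivity)).symm
      _ ≤ _ := by
          refine ENNReal.ofReal_le_ofReal ?_
          rw [h.weight_succ]
          have h3 : y ^ (-s) ≤ 4 * b n ^ (-s) := by
            calc y ^ (-s) ≤ (b n / 2) ^ (-s) :=
                  Real.rpow_le_rpow_of_nonpos (by positivity) (by linarith) (by linarith)
              _ = b n ^ (-s) * 2 ^ s := by
                  rw [Real.div_rpow hb.le two_pos.le, Real.rpow_neg two_pos.le, div_inv_eq_mul]
              _ ≤ b n ^ (-s) * 2 ^ (2 : ℝ) := by
                  gcongr
                  · norm_num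
                  · exact h.lt_two.le
              _ = _ := by
                  rw [Real.rpow_two]
                  ring
          have hp := h.weight_pos n
          calc (4 * K)⁻¹ * y ^ (-s) * (K * p n) = p n * (y ^ (-s) / 4) := by
                field_simp
            _ ≤ p n * b n ^ (-s) := by
                gcongr
                linarith

/-- The contribution of the right end of a block to the convolution of `μ` with itself is
dominated by the part of `tailConv μ` between this block and the next. -/
lemma exists_block_end_le {δ : ℝ} (hδ : 0 < δ) : ∃ (c : ℝ) (N : ℕ), ∀ n ≥ N, ∀ x, e n + c ≤ x →
    ENNReal.ofReal (p n / b n) * μ (Ioi (x - e n)) ≤ ENNReal.ofReal δ *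
      ∫⁻ z in Ico (b n) (b (n + 1)) ∩ Icc 0 x, μ (Ioi z) * μ (Ioi (x - z)) := by
  have hK : 0 < K := one_pos.trans_le h.one_le
  have hs1 := h.one_lt
  have hs2 := h.lt_two
  -- The constant `16 K` is `4 K` from the doubling bound times two factors `2` from `y / 2` in the
  -- second case below; `s < 2` makes the power grow.
  obtain ⟨c, hc1, hc⟩ : ∃ c : ℝ, 1 ≤ c ∧ ∀ y ≥ c, 16 * K / δ ≤ y ^ (2 - s) := by
    obtain ⟨c, hc⟩ := eventually_atTop.1
      ((tendsto_rpow_atTop (by linarith : 0 < 2 - s)).eventually_ge_atTop (16 * K / δ))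
    exact ⟨max 1 c, le_max_left _ _, fun y hy => hc y ((le_max_right _ _).trans hy)⟩
  obtain ⟨N, hN⟩ : ∃ N : ℕ, ∀ n ≥ N, δ⁻¹ * b n ^ (s - 1) ≤ b n / 8 := by
    have hlim := (tendsto_rpow_atTop (by linarith : 0 < 2 - s)).comp h.tendsto_left
    obtain ⟨N, hN⟩ := eventually_atTop.1 (hlim.eventually_ge_atTop (8 / δ))
    refine ⟨N, fun n hn => ?_⟩
    have h1 : 8 / δ ≤ b n ^ (2 - s) := hN n hn
    have hb := h.left_pos n
    have h2 : b n ^ (2 - s) * b n ^ (s - 1) = b n := by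
      rw [← Real.rpow_add hb]
      norm_num
    have h3 : 0 < b n ^ (s - 1) := Real.rpow_pos_of_pos hb _
    have h4 : 8 / δ * b n ^ (s - 1) ≤ b n := (mul_le_mul_of_nonneg_right h1 h3.le).trans h2.le
    have h5 : 8 / δ * b n ^ (s - 1) = 8 * (δ⁻¹ * b n ^ (s - 1)) := by ring
    linarith
  refine ⟨c, N, fun n hn x hx => ?_⟩
  have hb := h.left_pos n
  have hp := h.weight_pos n
  have hbe := h.left_le_right n
  have heb := h.right_le_left_succ n
  set y := x - e n with hy
  have hyc : c ≤ y := by linarith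
  have hy0 : 0 < y := by linarith
  set l := δ⁻¹ * b n ^ (s - 1) with hl
  have hl0 : 0 < l := by positivity
  have hlb := hN n hn
  rcases le_or_gt l y with hcase | hcase
  -- Far from the block end, use the gap after it: the tail there is at least `pₙ₊₁ = pₙ bₙ^{-s}`,
  -- and `l` is the length for which `pₙ₊₁ l = δ⁻¹ pₙ / bₙ`.
  · have hsub : Ico (e n) (e n + l) ⊆ Ico (b n) (b (n + 1)) ∩ Icc 0 x := fun z hz =>
      ⟨⟨by linarith [hz.1], by linarith [hz.2]⟩, by linarith [hz.1], by linarith [hz.2]⟩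
    have hpow : p (n + 1) * l = δ⁻¹ * (p n / b n) := by
      rw [h.weight_succ, hl]
      have : b n ^ (-s) * b n ^ (s - 1) = (b n)⁻¹ := by
        rw [← Real.rpow_add hb, ← Real.rpow_neg_one]
        congr 1
        ring
      calc _ = δ⁻¹ * p n * (b n ^ (-s) * b n ^ (s - 1)) := by ring
        _ = _ := by
          rw [this]
          ring
    calc ENNReal.ofReal (p n / b n) * μ (Ioi y)
        = ENNReal.ofReal δ * (ENNReal.ofReal (p (n + 1)) * μ (Ioi y) * ENNReal.ofReal l) := by
          rw [mul_right_comm, ← ENNReal.ofReal_mul (h.weight_pos _).le, hpow, ← mul_assoc,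
            ← ENNReal.ofReal_mul hδ.le, mul_inv_cancel_left₀ hδ.ne']
      _ = ENNReal.ofReal δ *
          ∫⁻ _ in Ico (e n) (e n + l), ENNReal.ofReal (p (n + 1)) * μ (Ioi y) := by
          rw [setLIntegral_const, Real.volume_Ico, add_sub_cancel_left]
      _ ≤ ENNReal.ofReal δ *
          ∫⁻ z in Ico (e n) (e n + l), μ (Ioi z) * μ (Ioi (x - z)) := by
          refine mul_le_mul_right (setLIntegral_mono' measurableSet_Ico fun z hz => ?_) _
          refine mul_le_mul' (h.weight_le_tail ((hsub hz).1.2)) (measure_mono (Ioi_subset_Ioi ?_))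
          linarith [hz.1]
      _ ≤ _ := by
          gcongr
  -- Close to the block end, use the block itself: on this interval `μ̄(z) ≥ pₙ (y / 2) / bₙ` and `x
  -- - z ≤ 2y`. The bound `y < l ≤ bₙ / 8` keeps the interval inside the block.
  · have hsub : Icc (e n - y) (e n - y / 2) ⊆ Ico (b n) (b (n + 1)) ∩ Icc 0 x := fun z hz =>
      ⟨⟨by linarith [hz.1], by linarith [hz.2]⟩, by linarith [hz.1], by linarith [hz.2]⟩
    have hpow : p n / b n ≤
        δ * (p n * (y / 2 / b n) * ((4 * K)⁻¹ * y ^ (-s)) * (y / 2)) := by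
      have h1 : y ^ (-s) * y * y = y ^ (2 - s) := by
        rw [← Real.rpow_add_one hy0.ne', ← Real.rpow_add_one hy0.ne']
        congr 1
        ring
      have h2 := hc y hyc
      calc p n / b n = p n / b n * (δ / (16 * K) * (16 * K / δ)) := by
            field_simp
        _ ≤ p n / b n * (δ / (16 * K) * y ^ (2 - s)) := by gcongr
        _ = _ := by
            rw [← h1]
            field_simp
            ring
    calc ENNReal.ofReal (p n / b n) * μ (Ioi y)
        ≤ ENNReal.ofReal (δ * (p n * (y / 2 / b n) * ((4 * K)⁻¹ * y ^ (-s)) * (y / 2))) *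
            μ (Ioi y) := by gcongr
      _ = ENNReal.ofReal δ * (ENNReal.ofReal (p n * (y / 2 / b n)) *
          (ENNReal.ofReal ((4 * K)⁻¹ * y ^ (-s)) * μ (Ioi y)) * ENNReal.ofReal (y / 2)) := by
          rw [ENNReal.ofReal_mul hδ.le, ENNReal.ofReal_mul (by positivity),
            ENNReal.ofReal_mul (by positivity)]
          ring
      _ ≤ ENNReal.ofReal δ * (ENNReal.ofReal (p n * (y / 2 / b n)) *
          μ (Ioi (2 * y)) * ENNReal.ofReal (y / 2)) := by
          gcongr
          exact h.tail_le_tail_two_mul (hc1.trans hyc)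
      _ = ENNReal.ofReal δ * ∫⁻ _ in Icc (e n - y) (e n - y / 2),
            ENNReal.ofReal (p n * (y / 2 / b n)) * μ (Ioi (2 * y)) := by
          rw [setLIntegral_const, Real.volume_Icc]
          congr 3
          ring
      _ ≤ ENNReal.ofReal δ *
          ∫⁻ z in Icc (e n - y) (e n - y / 2), μ (Ioi z) * μ (Ioi (x - z)) := by
          refine mul_le_mul_right (setLIntegral_mono' measurableSet_Icc fun z hz => ?_) _
          have hz1 := hz.1
          have hz2 := hz.2
          refine mul_le_mul' (le_trans (ENNReal.ofReal_le_ofReal ?_)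
            (h.le_tail_of_mem (n := n) ⟨by linarith, by linarith⟩))
            (measure_mono (Ioi_subset_Ioi (by linarith)))
          gcongr
          linarith
      _ ≤ _ := by
          gcongr

/-- At distance at least `A` from the right end, the density bound `4 / bₙ` is at most `4 / A` times
the tail of the block. The last stretch of length `A` has mass at most `4 A / bₙ`, and it meets the
domain of integration only if `eₙ + d ≤ x`. -/
lemma block_lintegral_le {A : ℝ} (hA : 0 < A) (n : ℕ) {x d : ℝ} (hd : 0 ≤ d) :
    ∫⁻ z in Iic (x - d - A), μ (Ioi (x - z)) ∂ν n ≤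
      ENNReal.ofReal (4 / A) * (∫⁻ z in Icc 0 x, ν n (Ioi z) * μ (Ioi (x - z))) +
      if e n + d ≤ x then ENNReal.ofReal (4 * A / b n) * μ (Ioi (x - e n)) else 0 := by
  have hb := h.left_pos n
  have hm := measurable_measure_Ioi_sub μ x
  set B := Iic (x - d - A) with hB
  have hle : ∫⁻ z in B, μ (Ioi (x - z)) ∂ν n ≤
      ENNReal.ofReal (4 / b n) * ∫⁻ z in B ∩ Icc (b n) (e n), μ (Ioi (x - z)) := by
    calc ∫⁻ z in B, μ (Ioi (x - z)) ∂ν n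
        ≤ ∫⁻ z in B, μ (Ioi (x - z))
            ∂(ENNReal.ofReal (4 / b n) • volume.restrict (Icc (b n) (e n))) :=
          lintegral_mono' (Measure.restrict_mono le_rfl (h.block_le_volume n)) le_rfl
      _ = _ := by
          rw [Measure.restrict_smul, lintegral_smul_measure,
            Measure.restrict_restrict measurableSet_Iic, smul_eq_mul]
  have hsub : B ∩ Icc (b n) (e n) ⊆
      (B ∩ Icc (b n) (e n - A)) ∪ (B ∩ Icc (e n - A) (e n)) := fun z hz => by
    rcases le_total z (e n - A) with h1 | h1
    · exact Or.inl ⟨hz.1, hz.2.1, h1⟩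
    · exact Or.inr ⟨hz.1, h1, hz.2.2⟩
  refine hle.trans ((mul_le_mul_right ((lintegral_mono_set hsub).trans
    (lintegral_union_le _ _ _)) _).trans ?_)
  rw [mul_add]
  refine add_le_add ?_ ?_
  · rw [← lintegral_const_mul _ hm, ← lintegral_const_mul _
      (measurable_tail_mul_tail (ν n) μ x)]
    calc ∫⁻ z in B ∩ Icc (b n) (e n - A), ENNReal.ofReal (4 / b n) * μ (Ioi (x - z))
        ≤ ∫⁻ z in B ∩ Icc (b n) (e n - A),
          ENNReal.ofReal (4 / A) * (ν n (Ioi z) * μ (Ioi (x - z))) := by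
          refine setLIntegral_mono' (measurableSet_Iic.inter measurableSet_Icc) fun z hz => ?_
          rw [← mul_assoc]
          gcongr
          have hz2 := hz.2.2
          calc ENNReal.ofReal (4 / b n)
              ≤ ENNReal.ofReal (4 / A * ((e n - z) / b n)) := by
                refine ENNReal.ofReal_le_ofReal ?_
                rw [div_mul_div_comm, div_le_div_iff₀ hb (by positivity)]
                nlinarith
            _ = ENNReal.ofReal (4 / A) * ENNReal.ofReal ((e n - z) / b n) :=
                ENNReal.ofReal_mul (by positivity)
            _ ≤ _ := by
                gcongr
                exact h.le_block_Ioi n z ⟨hz.2.1, by linarith⟩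
      _ ≤ _ := lintegral_mono_set fun z hz => by
          have h1 : z ≤ x - d - A := hz.1
          exact ⟨hb.le.trans hz.2.1, by linarith⟩
  · split_ifs with hcase
    · calc ENNReal.ofReal (4 / b n) * ∫⁻ z in B ∩ Icc (e n - A) (e n), μ (Ioi (x - z))
          ≤ ENNReal.ofReal (4 / b n) * ∫⁻ _ in Icc (e n - A) (e n), μ (Ioi (x - e n)) := by
            gcongr ENNReal.ofReal (4 / b n) * ?_
            refine (lintegral_mono_set inter_subset_right).trans
              (setLIntegral_mono' measurableSet_Icc fun z hz => ?_)
            exact measure_mono (Ioi_subset_Ioi (by linarith [hz.2]))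
        _ = ENNReal.ofReal (4 * A / b n) * μ (Ioi (x - e n)) := by
            rw [setLIntegral_const, Real.volume_Icc, sub_sub_cancel, mul_comm (μ _), ← mul_assoc,
              ← ENNReal.ofReal_mul (by positivity)]
            congr 2
            ring
    · have : B ∩ Icc (e n - A) (e n) = ∅ := by
        ext z
        simp only [hB, mem_inter_iff, mem_Iic, mem_Icc, mem_empty_iff_false, iff_false]
        rintro ⟨h1, h2, -⟩
        linarith
      simp [this]

/-- The tail of `μ * μ` is negligible with respect to the convolution of the tails. -/
lemma negligible_conv : Negligible (fun x => (μ.conv μ) (Ioi x)) (tailConv μ) := by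
  have hprob := h.isProbabilityMeasure
  intro ε hε
  have hε3 : ε / 3 ≠ 0 := ENNReal.div_ne_zero.2 ⟨hε, by simp⟩
  obtain ⟨η, hη0, -, hη⟩ := exists_pos_ofReal_le hε3
  -- With this `A` the bulk of each block costs the factor `4 / A = η`; the tolerance `η / (4 A)`
  -- below cancels the factor `4 A` at the block ends.
  set A := 4 / η with hA
  have hA0 : 0 < A := by positivity
  obtain ⟨c, N, hcN⟩ := h.exists_block_end_le (δ := η / (4 * A)) (by positivity)
  wlog hc0 : 0 ≤ c generalizing c
  · exact this 0 (fun n hn x hx => hcN n hn x (by linarith)) le_rfl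
  -- The shift by `c + A` pays for the values beyond `x - c - A`, the shift by `e N` for the blocks
  -- before `N`.
  have hsmall := ((negligible_tail_shift h.lintegral_tail (c + A)).add
    (negligible_tail_shift h.lintegral_tail (e N))) _ hε3
  filter_upwards [hsmall] with x hx
  have hm := measurable_measure_Ioi_sub μ x
  have hterm : ∀ n, ENNReal.ofReal (p n) * ∫⁻ z in Iic (x - c - A), μ (Ioi (x - z)) ∂ν n ≤
      ENNReal.ofReal (p n) * μ (Ioi (x - e N)) +
      (ENNReal.ofReal η * (∫⁻ z in Icc 0 x,
        ENNReal.ofReal (p n) * ν n (Ioi z) * μ (Ioi (x - z))) +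
      ENNReal.ofReal η * ∫⁻ z in Ico (b n) (b (n + 1)) ∩ Icc 0 x,
        μ (Ioi z) * μ (Ioi (x - z))) := by
    intro n
    rcases lt_or_ge n N with hn | hn
    · refine le_trans ?_ le_self_add
      gcongr
      have := h.isProbabilityMeasure_block n
      calc ∫⁻ z in Iic (x - c - A), μ (Ioi (x - z)) ∂ν n
          ≤ ∫⁻ z, μ (Ioi (x - z)) ∂ν n := setLIntegral_le_lintegral _ _
        _ ≤ ∫⁻ _, μ (Ioi (x - e N)) ∂ν n := by
            refine lintegral_mono_ae ?_
            have hae : ∀ᵐ z ∂ν n, z ∈ Icc (b n) (e n) := h.block_compl n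
            filter_upwards [hae] with z hz
            have := h.strictMono_right hn
            exact measure_mono (Ioi_subset_Ioi (by linarith [hz.2]))
        _ = _ := by simp
    · refine le_trans ?_ le_add_self
      refine (mul_le_mul_right (h.block_lintegral_le hA0 n hc0) _).trans ?_
      rw [mul_add]
      refine add_le_add ?_ ?_
      · have h4 : 4 / A = η := by
          rw [hA]
          field_simp
        simp_rw [h4, mul_assoc]
        rw [lintegral_const_mul _ (measurable_tail_mul_tail (ν n) μ x), mul_left_comm]
      · split_ifs with hcase
        · calc ENNReal.ofReal (p n) * (ENNReal.ofReal (4 * A / b n) * μ (Ioi (x - e n)))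
              = ENNReal.ofReal (4 * A) *
                (ENNReal.ofReal (p n / b n) * μ (Ioi (x - e n))) := by
                rw [← mul_assoc, ← mul_assoc, ← ENNReal.ofReal_mul (h.weight_pos n).le,
                  ← ENNReal.ofReal_mul (by positivity)]
                congr 2
                ring
            _ ≤ ENNReal.ofReal (4 * A) * (ENNReal.ofReal (η / (4 * A)) *
                ∫⁻ z in Ico (b n) (b (n + 1)) ∩ Icc 0 x, μ (Ioi z) * μ (Ioi (x - z))) := by
                exact mul_le_mul_right (hcN n hn x hcase) _
            _ = _ := by
                rw [← mul_assoc, ← ENNReal.ofReal_mul (by positivity)]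
                congr 2
                field_simp
        · simp
  have hsum_p : ∑' n, ENNReal.ofReal (p n) = 1 := by
    have h1 := hprob.measure_univ
    rw [h.eq_sum, Measure.sum_apply _ MeasurableSet.univ] at h1
    rw [← h1]
    refine tsum_congr fun n => ?_
    have := h.isProbabilityMeasure_block n
    simp
  have hsum_block : ∑' n, ∫⁻ z in Icc 0 x,
      ENNReal.ofReal (p n) * ν n (Ioi z) * μ (Ioi (x - z)) = tailConv μ x := by
    have hmeas : ∀ n, Measurable fun z =>
        ENNReal.ofReal (p n) * ν n (Ioi z) * μ (Ioi (x - z)) := fun n =>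
      ((measurable_measure_Ioi (ν n)).const_mul _).mul hm
    rw [tailConv, ← lintegral_tsum fun n => (hmeas n).aemeasurable]
    refine lintegral_congr fun z => ?_
    rw [ENNReal.tsum_mul_right, ← h.tail_eq]
  -- The pieces charged for different block ends are disjoint, so together they cost at most one
  -- copy of `tailConv μ x`.
  have hsum_gap : ∑' n, ∫⁻ z in Ico (b n) (b (n + 1)) ∩ Icc 0 x,
      μ (Ioi z) * μ (Ioi (x - z)) ≤ tailConv μ x := by
    rw [← lintegral_iUnion (fun n => measurableSet_Ico.inter measurableSet_Icc)]
    · exact lintegral_mono_set (iUnion_subset fun n => inter_subset_right)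
    · intro i j hij
      exact (h.strictMono_left.monotone.pairwise_disjoint_on_Ico_succ hij).mono
        inter_subset_left inter_subset_left
  have hmain : ∫⁻ z in Iic (x - c - A), μ (Ioi (x - z)) ∂μ ≤
      μ (Ioi (x - e N)) + (ENNReal.ofReal η * tailConv μ x + ENNReal.ofReal η * tailConv μ x) := by
    calc ∫⁻ z in Iic (x - c - A), μ (Ioi (x - z)) ∂μ
        = ∑' n, ENNReal.ofReal (p n) * ∫⁻ z in Iic (x - c - A), μ (Ioi (x - z)) ∂ν n := by
          conv_lhs => rw [h.eq_sum]
          rw [Measure.restrict_sum _ measurableSet_Iic, lintegral_sum_measure]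
          refine tsum_congr fun n => ?_
          rw [Measure.restrict_smul, lintegral_smul_measure, smul_eq_mul, ← h.eq_sum]
      _ ≤ _ := ENNReal.tsum_le_tsum hterm
      _ ≤ _ := by
          rw [ENNReal.tsum_add, ENNReal.tsum_add, ENNReal.tsum_mul_right, ENNReal.tsum_mul_left,
            ENNReal.tsum_mul_left, hsum_p, one_mul, hsum_block]
          gcongr
  calc (μ.conv μ) (Ioi x)
      = ∫⁻ z in Iic (x - c - A), μ (Ioi (x - z)) ∂μ +
          ∫⁻ z in Ioi (x - c - A), μ (Ioi (x - z)) ∂μ := by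
        rw [conv_apply_Ioi, ← lintegral_add_compl _ (measurableSet_Iic (a := x - c - A)),
          compl_Iic]
    _ ≤ (μ (Ioi (x - e N)) + (ENNReal.ofReal η * tailConv μ x +
          ENNReal.ofReal η * tailConv μ x)) + μ (Ioi (x - (c + A))) := by
        refine add_le_add hmain ?_
        calc ∫⁻ z in Ioi (x - c - A), μ (Ioi (x - z)) ∂μ
            ≤ ∫⁻ _ in Ioi (x - c - A), 1 ∂μ := lintegral_mono fun z => prob_le_one
          _ = _ := by simp [sub_sub]
    _ = (μ (Ioi (x - (c + A))) + μ (Ioi (x - e N))) + (ENNReal.ofReal η * tailConv μ x +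
          ENNReal.ofReal η * tailConv μ x) := by ring
    _ ≤ ε / 3 * tailConv μ x + (ε / 3 * tailConv μ x + ε / 3 * tailConv μ x) := by
        gcongr
    _ = ε * tailConv μ x := by
        rw [← add_mul, ← add_mul, ← add_assoc, ENNReal.add_thirds]

end

end IsBlockMixture

/-! ### The law `xiLaw` is a block mixture -/

lemma rpow_sub_rpow_le {s z w : ℝ} (hs2 : s < 2) (hz : 0 < z) (hzw : z ≤ w) :
    w ^ s - z ^ s ≤ 2 * w ^ (s - 1) * (w - z) := by
  have hw : 0 < w := hz.trans_le hzw
  set q := z / w with hq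
  have hq0 : 0 < q := div_pos hz hw
  have hq1 : q ≤ 1 := (div_le_one hw).2 hzw
  have hzq : z = w * q := by
    rw [hq]
    field_simp
  -- After scaling, `1 - q^s ≤ 1 - q² ≤ 2 (1 - q)` replaces the mean value theorem.
  have h1 : q ^ (2 : ℝ) ≤ q ^ s := Real.rpow_le_rpow_of_exponent_ge hq0 hq1 hs2.le
  rw [Real.rpow_two] at h1
  have h2 : w ^ (s - 1) * w = w ^ s := by
    rw [← Real.rpow_add_one hw.ne', sub_add_cancel]
  have h3 : 0 < w ^ s := Real.rpow_pos_of_pos hw s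
  calc w ^ s - z ^ s = w ^ s * (1 - q ^ s) := by
        rw [hzq, Real.mul_rpow hw.le hq0.le]
        ring
    _ ≤ w ^ s * (2 * (1 - q)) := by
        gcongr
        nlinarith [sq_nonneg (1 - q)]
    _ = 2 * w ^ (s - 1) * (w - z) := by
        rw [← h2, hzq]
        ring

lemma mul_sub_le_rpow_sub_rpow {s z w : ℝ} (hs1 : 1 < s) (hz : 0 < z) (hzw : z ≤ w) :
    w ^ (s - 1) * (w - z) ≤ w ^ s - z ^ s := by
  have hw : 0 < w := hz.trans_le hzw
  have h1 : w ^ (s - 1) * w = w ^ s := by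
    rw [← Real.rpow_add_one hw.ne', sub_add_cancel]
  have h2 : z ^ (s - 1) * z = z ^ s := by
    rw [← Real.rpow_add_one hz.ne', sub_add_cancel]
  have h3 : z ^ (s - 1) ≤ w ^ (s - 1) := Real.rpow_le_rpow hz.le hzw (by linarith)
  rw [← h1, ← h2]
  nlinarith

instance uniformLaw_isProbabilityMeasure : IsProbabilityMeasure uniformLaw :=
  ⟨by simp [uniformLaw]⟩

/-- The law of `b (1 + U)^{1/s}` with `U` uniformly distributed on `(0, 1)`. -/
noncomputable def blockLaw (s b : ℝ) : Measure ℝ :=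
  uniformLaw.map fun u => b * (1 + u) ^ (1 / s)

section BlockLaw

variable {s b : ℝ}

lemma measurable_blockMap : Measurable fun u : ℝ => b * (1 + u) ^ (1 / s) := by fun_prop

instance blockLaw_isProbabilityMeasure : IsProbabilityMeasure (blockLaw s b) :=
  Measure.isProbabilityMeasure_map measurable_blockMap.aemeasurable

lemma two_rpow_inv_mul_rpow (hs1 : 1 < s) (hb : 0 < b) : (2 ^ (1 / s) * b) ^ s = 2 * b ^ s := by
  rw [Real.mul_rpow (by positivity) hb.le, ← Real.rpow_mul two_pos.le,
    one_div_mul_cancel (by linarith), Real.rpow_one]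

lemma two_rpow_inv_le (hs1 : 1 < s) : (2 : ℝ) ^ (1 / s) ≤ 2 := by
  calc (2 : ℝ) ^ (1 / s) ≤ 2 ^ (1 : ℝ) := by
        refine Real.rpow_le_rpow_of_exponent_le one_le_two ?_
        rw [div_le_one (by linarith)]
        exact hs1.le
    _ = 2 := Real.rpow_one 2

lemma le_two_rpow_inv (hs1 : 1 < s) (hs2 : s < 2) : 5 / 4 ≤ (2 : ℝ) ^ (1 / s) := by
  calc (5 / 4 : ℝ) ≤ √2 := Real.le_sqrt_of_sq_le (by norm_num)
    _ = 2 ^ (1 / 2 : ℝ) := Real.sqrt_eq_rpow 2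
    _ ≤ 2 ^ (1 / s) := by
        refine Real.rpow_le_rpow_of_exponent_le one_le_two ?_
        exact one_div_le_one_div_of_le (by linarith) hs2.le

lemma blockMap_rpow (hs1 : 1 < s) (hb : 0 < b) {u : ℝ} (hu : 0 ≤ 1 + u) :
    (b * (1 + u) ^ (1 / s)) ^ s = b ^ s * (1 + u) := by
  rw [Real.mul_rpow hb.le (Real.rpow_nonneg hu _), ← Real.rpow_mul hu,
    one_div_mul_cancel (by linarith), Real.rpow_one]

lemma blockMap_mem_Icc (hs1 : 1 < s) (hb : 0 < b) {u : ℝ} (hu : u ∈ Ioo (0 : ℝ) 1) :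
    b * (1 + u) ^ (1 / s) ∈ Icc b (2 ^ (1 / s) * b) := by
  have hs : 0 < 1 / s := by positivity
  constructor
  · exact le_mul_of_one_le_right hb.le (Real.one_le_rpow (by linarith [hu.1]) hs.le)
  · rw [mul_comm]
    gcongr
    · linarith [hu.1]
    · linarith [hu.2]

/-- The inverse map `z ↦ z^s / b^s - 1` is Lipschitz on the block with constant `4 / b`, so it
enlarges one-dimensional Hausdorff measure, which is Lebesgue measure, by at most this factor. -/
lemma blockLaw_le_volume (hs1 : 1 < s) (hs2 : s < 2) (hb : 0 < b) :
    blockLaw s b ≤ ENNReal.ofReal (4 / b) • volume.restrict (Icc b (2 ^ (1 / s) * b)) := by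
  set e := 2 ^ (1 / s) * b with he
  have hbs : b ^ (s - 1) * b = b ^ s := by
    rw [← Real.rpow_add_one hb.ne', sub_add_cancel]
  have hbs0 : 0 < b ^ (s - 1) := Real.rpow_pos_of_pos hb _
  have hinc : ∀ z ∈ Icc b e, ∀ w ∈ Icc b e, z ≤ w →
      |(z ^ s / b ^ s - 1) - (w ^ s / b ^ s - 1)| ≤ 4 / b * |z - w| := by
    intro z hz w hw hzw
    have hz0 : 0 < z := hb.trans_le hz.1
    have h1 := rpow_sub_rpow_le hs2 hz0 hzw
    have h2 : z ^ s ≤ w ^ s := Real.rpow_le_rpow hz0.le hzw (by linarith)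
    have h3 : w ^ (s - 1) ≤ 2 * b ^ (s - 1) := by
      calc w ^ (s - 1) ≤ (2 * b) ^ (s - 1) := by
            refine Real.rpow_le_rpow (by linarith) ?_ (by linarith)
            exact hw.2.trans (by rw [he]; gcongr; exact two_rpow_inv_le hs1)
        _ = 2 ^ (s - 1) * b ^ (s - 1) := Real.mul_rpow two_pos.le hb.le
        _ ≤ 2 ^ (1 : ℝ) * b ^ (s - 1) := by
            gcongr
            · exact one_le_two
            linarith
        _ = _ := by rw [Real.rpow_one]
    rw [abs_sub_comm, abs_sub_comm z, abs_of_nonneg (by linarith : 0 ≤ w - z),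
      show w ^ s / b ^ s - 1 - (z ^ s / b ^ s - 1) = (w ^ s - z ^ s) / b ^ s by ring,
      abs_of_nonneg (div_nonneg (by linarith) (Real.rpow_nonneg hb.le s)), ← hbs,
      div_le_iff₀ (by positivity)]
    calc w ^ s - z ^ s ≤ 2 * w ^ (s - 1) * (w - z) := h1
      _ ≤ 2 * (2 * b ^ (s - 1)) * (w - z) := by
          gcongr
      _ = 4 / b * (w - z) * (b ^ (s - 1) * b) := by
          field_simp
          ring
  have hlip : LipschitzOnWith (4 / b).toNNReal (fun z : ℝ => z ^ s / b ^ s - 1) (Icc b e) := by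
    refine LipschitzOnWith.of_dist_le_mul fun z hz w hw => ?_
    rw [Real.coe_toNNReal _ (by positivity), Real.dist_eq, Real.dist_eq]
    rcases le_total z w with h | h
    · exact hinc z hz w hw h
    · rw [abs_sub_comm, abs_sub_comm z]
      exact hinc w hw z hz h
  refine Measure.le_iff.2 fun B hB => ?_
  rw [blockLaw, Measure.map_apply measurable_blockMap hB, uniformLaw,
    Measure.restrict_apply (measurable_blockMap hB), Measure.smul_apply, smul_eq_mul,
    Measure.restrict_apply hB]
  have hsub : (fun u : ℝ => b * (1 + u) ^ (1 / s)) ⁻¹' B ∩ Ioo 0 1 ⊆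
      (fun z : ℝ => z ^ s / b ^ s - 1) '' (B ∩ Icc b e) := by
    rintro u ⟨huB, hu⟩
    refine ⟨b * (1 + u) ^ (1 / s), ⟨huB, blockMap_mem_Icc hs1 hb hu⟩, ?_⟩
    have : b ^ s ≠ 0 := (Real.rpow_pos_of_pos hb s).ne'
    simp only [blockMap_rpow hs1 hb (by linarith [hu.1] : 0 ≤ 1 + u)]
    field_simp
    ring
  have himg := (hlip.mono inter_subset_right).hausdorffMeasure_image_le (s := B ∩ Icc b e)
    (zero_le_one (α := ℝ))
  rw [hausdorffMeasure_real, ENNReal.rpow_one] at himg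
  exact (measure_mono hsub).trans himg

/-- With `e = 2^{1/s} b`, the mass beyond `z` is at least `2 - z^s / b^s = (e^s - z^s) / b^s`, and
`e^s - z^s ≥ e^{s-1} (e - z) ≥ b^{s-1} (e - z)`. -/
lemma le_blockLaw_Ioi (hs1 : 1 < s) (hb : 0 < b) {z : ℝ} (hz : z ∈ Icc b (2 ^ (1 / s) * b)) :
    ENNReal.ofReal ((2 ^ (1 / s) * b - z) / b) ≤ blockLaw s b (Ioi z) := by
  set e := 2 ^ (1 / s) * b with he
  have hz0 : 0 < z := hb.trans_le hz.1
  have hbs : b ^ (s - 1) * b = b ^ s := by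
    rw [← Real.rpow_add_one hb.ne', sub_add_cancel]
  have hbs0 : 0 < b ^ (s - 1) := Real.rpow_pos_of_pos hb _
  have hbs1 : 0 < b ^ s := Real.rpow_pos_of_pos hb _
  rw [blockLaw, Measure.map_apply measurable_blockMap measurableSet_Ioi, uniformLaw,
    Measure.restrict_apply (measurable_blockMap measurableSet_Ioi)]
  have hsub : Ioo (z ^ s / b ^ s - 1) 1 ⊆
      (fun u : ℝ => b * (1 + u) ^ (1 / s)) ⁻¹' Ioi z ∩ Ioo 0 1 := by
    intro u hu
    have h0 : 1 ≤ z ^ s / b ^ s := by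
      rw [one_le_div hbs1]
      exact Real.rpow_le_rpow hb.le hz.1 (by linarith)
    have hu0 : 0 < u := by linarith [hu.1]
    refine ⟨?_, hu0, hu.2⟩
    have h1 : z ^ s / b ^ s < 1 + u := by linarith [hu.1]
    rw [div_lt_iff₀ hbs1, mul_comm, ← blockMap_rpow hs1 hb (by linarith)] at h1
    exact lt_of_not_ge fun h2 => h1.not_ge (Real.rpow_le_rpow (by positivity) h2 (by linarith))
  refine le_trans ?_ (measure_mono hsub)
  rw [Real.volume_Ioo]
  refine ENNReal.ofReal_le_ofReal ?_
  have h1 := mul_sub_le_rpow_sub_rpow hs1 hz0 hz.2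
  rw [he, two_rpow_inv_mul_rpow hs1 hb, ← he] at h1
  have h2 : b ^ (s - 1) * (e - z) ≤ e ^ (s - 1) * (e - z) := by
    refine mul_le_mul_of_nonneg_right ?_ (by linarith [hz.2])
    exact Real.rpow_le_rpow hb.le (hz.1.trans hz.2) (by linarith)
  rw [div_le_iff₀ hb]
  calc e - z = b ^ (s - 1) * (e - z) / b ^ (s - 1) := by field_simp
    _ ≤ (2 * b ^ s - z ^ s) / b ^ (s - 1) := by
        gcongr
        exact h2.trans h1
    _ = (1 - (z ^ s / b ^ s - 1)) * b := by
        rw [← hbs]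
        field_simp
        ring

end BlockLaw

section Parameters

variable {s α a : ℝ}

lemma le_aSeq (hα : 0 < α) (ha : 1 < a) (n : ℕ) : a ≤ aSeq α a n := by
  have h1 : (1 : ℝ) ≤ (1 + 1 / α) ^ n := one_le_pow₀ (by simp [hα.le])
  calc a = a ^ (1 : ℝ) := (Real.rpow_one a).symm
    _ ≤ _ := Real.rpow_le_rpow_of_exponent_le ha.le h1

lemma aSeq_pos (hα : 0 < α) (ha : 1 < a) (n : ℕ) : 0 < aSeq α a n := by
  linarith [le_aSeq hα ha n]

lemma aSeq_succ (hα : 0 < α) (ha : 1 < a) (n : ℕ) :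
    aSeq α a (n + 1) = aSeq α a n * aSeq α a n ^ (1 / α) := by
  have h0 := aSeq_pos hα ha n
  rw [mul_comm, ← Real.rpow_add_one h0.ne', aSeq, aSeq, ← Real.rpow_mul (by linarith), pow_succ,
    add_comm (1 / α)]

/-- The exponent `r = 1 + 1/α` satisfies `rα = α + 1`. As `aₙ = bₙ^s`, this is the weight recursion
of a block mixture; it also makes the weights decay at least geometrically. -/
lemma aSeq_succ_rpow_neg (hα : 0 < α) (ha : 1 < a) (n : ℕ) :
    aSeq α a (n + 1) ^ (-α) = aSeq α a n ^ (-α) * (aSeq α a n)⁻¹ := by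
  have h0 := aSeq_pos hα ha n
  rw [aSeq_succ hα ha, Real.mul_rpow h0.le (by positivity), ← Real.rpow_mul h0.le,
    ← Real.rpow_neg_one]
  congr 2
  field_simp

lemma aSeq_add_rpow_neg_le (hα : 0 < α) (ha : 1 < a) (n k : ℕ) :
    aSeq α a (k + n) ^ (-α) ≤ aSeq α a n ^ (-α) * a⁻¹ ^ k := by
  induction k with
  | zero => simp
  | succ k ih =>
    have h0 := aSeq_pos hα ha n
    rw [add_right_comm, aSeq_succ_rpow_neg hα ha, pow_succ, ← mul_assoc]
    exact mul_le_mul ih (inv_anti₀ (by linarith) (le_aSeq hα ha _))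
      (inv_nonneg.2 (aSeq_pos hα ha _).le) (by positivity)

lemma summable_aSeq_rpow_neg (hα : 0 < α) (ha : 1 < a) (n : ℕ) :
    Summable fun k => aSeq α a (k + n) ^ (-α) := by
  refine Summable.of_nonneg_of_le (fun k => Real.rpow_nonneg (aSeq_pos hα ha _).le _)
    (aSeq_add_rpow_neg_le hα ha n) (Summable.mul_left _ ?_)
  exact summable_geometric_of_lt_one (by positivity) (inv_lt_one_of_one_lt₀ ha)

lemma xiLaw_eq_sum : xiLaw s α a = Measure.sum fun n : ℕ =>
    ENNReal.ofReal ((∑' i : ℕ, aSeq α a i ^ (-α))⁻¹ * aSeq α a n ^ (-α)) •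
      blockLaw s (aSeq α a n ^ (1 / s)) := by
  have hm : Measurable fun q : ℝ × ℝ => q.1 ^ (1 / s) * (1 + q.2) ^ (1 / s) := by fun_prop
  rw [xiLaw, etaLaw, Measure.prod_sum_left, Measure.map_sum hm.aemeasurable]
  congr 1 with n : 1
  rw [Measure.prod_smul_left, Measure.map_smul, Measure.dirac_prod,
    Measure.map_map hm measurable_prodMk_left]
  rfl

lemma isBlockMixture_xiLaw (hs1 : 1 < s) (hs2 : s < 2) (hα1 : 1 - 1 / s < α) (hα2 : α < 1 / s)
    (ha : 1 < a) (har : (2 : ℝ) ^ (s + 2) * a < a ^ (1 + 1 / α)) :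
    IsBlockMixture s (1 - a⁻¹)⁻¹ (xiLaw s α a)
      (fun n => (∑' i : ℕ, aSeq α a i ^ (-α))⁻¹ * aSeq α a n ^ (-α))
      (fun n => aSeq α a n ^ (1 / s)) (fun n => 2 ^ (1 / s) * aSeq α a n ^ (1 / s))
      (fun n => blockLaw s (aSeq α a n ^ (1 / s))) := by
  have hs0 : 0 < s := by linarith
  have hα : 0 < α := by
    have : 1 / s < 1 := (div_lt_one hs0).2 hs1
    linarith
  have ha0 : 0 < a := by linarith
  have hpos := aSeq_pos hα ha
  have hb : ∀ n, 0 < aSeq α a n ^ (1 / s) := fun n => Real.rpow_pos_of_pos (hpos n) _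
  have hgrow : (2 : ℝ) ^ (s + 2) ≤ a ^ (1 / α) := by
    rw [add_comm 1 (1 / α), Real.rpow_add_one ha0.ne'] at har
    exact (lt_of_mul_lt_mul_right har ha0.le).le
  have hgrow' : ∀ n, (2 : ℝ) ^ (s + 2) ≤ aSeq α a n ^ (1 / α) := fun n =>
    hgrow.trans (Real.rpow_le_rpow ha0.le (le_aSeq hα ha n) (by positivity))
  -- The growth condition on `a` separates the blocks: `2^{(s+2)/s} ≥ 4` because `s ≤ 2`.
  have hfour : ∀ n, 4 * aSeq α a n ^ (1 / s) ≤ aSeq α a (n + 1) ^ (1 / s) := fun n => by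
    rw [aSeq_succ hα ha, Real.mul_rpow (hpos n).le (by have := hpos n; positivity), mul_comm]
    refine mul_le_mul_of_nonneg_left ?_ (hb n).le
    calc (4 : ℝ) = (2 ^ (2 * s)) ^ (1 / s) := by
          rw [← Real.rpow_mul two_pos.le, mul_assoc, mul_one_div_cancel hs0.ne', mul_one,
            Real.rpow_two]
          norm_num
      _ ≤ (2 ^ (s + 2)) ^ (1 / s) := by
          gcongr
          · exact one_le_two
          · linarith
      _ ≤ (aSeq α a n ^ (1 / α)) ^ (1 / s) := by
          gcongr
          exact hgrow' n
  have hatop : Tendsto (aSeq α a) atTop atTop := by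
    refine tendsto_atTop_of_geom_le (hpos 0) one_lt_two fun n => ?_
    rw [aSeq_succ hα ha, mul_comm]
    refine mul_le_mul_of_nonneg_left (le_trans ?_ (hgrow' n)) (hpos n).le
    calc (2 : ℝ) = 2 ^ (1 : ℝ) := (Real.rpow_one 2).symm
      _ ≤ _ := Real.rpow_le_rpow_of_exponent_le one_le_two (by linarith)
  have hw : ∀ n, 0 < aSeq α a n ^ (-α) := fun n => Real.rpow_pos_of_pos (hpos n) _
  have hsummable : Summable fun i => aSeq α a i ^ (-α) := summable_aSeq_rpow_neg hα ha 0
  have hC : 0 < ∑' i : ℕ, aSeq α a i ^ (-α) :=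
    hsummable.tsum_pos (fun i => (hw i).le) 0 (hw 0)
  have ha1 : a⁻¹ < 1 := inv_lt_one_of_one_lt₀ ha
  have hainv : 0 < a⁻¹ := inv_pos.2 ha0
  refine
  { one_lt := hs1
    lt_two := hs2
    one_le := one_le_inv_iff₀.2 ⟨by linarith, by linarith⟩
    isProbabilityMeasure := ⟨?_⟩
    isProbabilityMeasure_block := fun n => inferInstance
    eq_sum := xiLaw_eq_sum
    weight_pos := fun n => mul_pos (inv_pos.2 hC) (hw n)
    left_pos := hb
    weight_succ := fun n => ?_
    left_le_right := fun n => mul_le_mul_of_nonneg_right (le_two_rpow_inv hs1 hs2) (hb n).le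
    right_le_left := fun n => mul_le_mul_of_nonneg_right (two_rpow_inv_le hs1) (hb n).le
    right_le_left_succ := fun n => ?_
    tendsto_left := (tendsto_rpow_atTop (by positivity)).comp hatop
    tendsto_weight_mul_left := ?_
    block_le_volume := fun n => blockLaw_le_volume hs1 hs2 (hb n)
    le_block_Ioi := fun n z hz => le_blockLaw_Ioi hs1 (hb n) hz
    sum_weight_le := fun n => ?_ }
  · rw [xiLaw_eq_sum, Measure.sum_apply _ MeasurableSet.univ]
    simp only [Measure.smul_apply, measure_univ, smul_eq_mul, mul_one]
    rw [← ENNReal.ofReal_tsum_of_nonneg (fun n => (mul_pos (inv_pos.2 hC) (hw n)).le)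
      (hsummable.mul_left _), tsum_mul_left, inv_mul_cancel₀ hC.ne', ENNReal.ofReal_one]
  · rw [aSeq_succ_rpow_neg hα ha, ← Real.rpow_mul (hpos n).le, mul_neg,
      one_div_mul_cancel hs0.ne', Real.rpow_neg_one, mul_assoc]
  · have := mul_le_mul_of_nonneg_right (two_rpow_inv_le hs1) (hb n).le
    linarith [hfour n]
  -- The condition `α < 1/s` enters here: it makes `pₙ bₙ` unbounded and hence the mean infinite.
  · have hlim : Tendsto (fun n => aSeq α a n ^ (1 / s - α)) atTop atTop :=
      (tendsto_rpow_atTop (by linarith)).comp hatop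
    refine (hlim.const_mul_atTop (inv_pos.2 hC)).congr fun n => ?_
    rw [mul_assoc, ← Real.rpow_add (hpos n)]
    congr 2
    ring
  · have hs := (summable_aSeq_rpow_neg hα ha n).mul_left (∑' i : ℕ, aSeq α a i ^ (-α))⁻¹
    rw [← ENNReal.ofReal_tsum_of_nonneg (fun k => (mul_pos (inv_pos.2 hC) (hw (k + n))).le) hs]
    refine ENNReal.ofReal_le_ofReal ?_
    rw [tsum_mul_left, mul_left_comm]
    refine mul_le_mul_of_nonneg_left ?_ (inv_pos.2 hC).le
    calc ∑' k, aSeq α a (k + n) ^ (-α) ≤ ∑' k, aSeq α a n ^ (-α) * a⁻¹ ^ k :=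
          (summable_aSeq_rpow_neg hα ha n).tsum_le_tsum (aSeq_add_rpow_neg_le hα ha n)
            ((summable_geometric_of_lt_one hainv.le ha1).mul_left _)
      _ = _ := by rw [tsum_mul_left, tsum_geometric_of_lt_one hainv.le ha1, mul_comm]

end Parameters

/-! ### Comparison of tails and long-tailedness of the tail convolution -/

lemma isLittleO_tail {G G' : Measure ℝ} [IsFiniteMeasure G] [IsFiniteMeasure G']
    (h : Negligible (fun x => G (Ioi x)) fun x => G' (Ioi x)) : tail G =o[atTop] tail G' := by
  refine isLittleO_iff.2 fun c hc => ?_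
  filter_upwards [h (ENNReal.ofReal c) (ENNReal.ofReal_pos.2 hc).ne'] with x hx
  have := ENNReal.toReal_mono (ENNReal.mul_ne_top ENNReal.ofReal_ne_top (measure_ne_top _ _)) hx
  rw [ENNReal.toReal_mul, ENNReal.toReal_ofReal hc.le] at this
  rwa [tail, tail, Real.norm_of_nonneg measureReal_nonneg, Real.norm_of_nonneg measureReal_nonneg]

lemma measure_ext_of_Ioi {μ ν : Measure ℝ} [IsFiniteMeasure μ]
    (h : ∀ x, μ (Ioi x) = ν (Ioi x)) : μ = ν := by
  refine Measure.ext_of_Ioc μ ν fun a b hab => ?_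
  rw [← Ioi_sdiff_Ioi, measure_sdiff (Ioi_subset_Ioi hab.le) measurableSet_Ioi.nullMeasurableSet
    (measure_ne_top _ _), measure_sdiff (Ioi_subset_Ioi hab.le)
    measurableSet_Ioi.nullMeasurableSet (by rw [← h]; exact measure_ne_top _ _), h, h]

lemma tailConv_ne_top (μ : Measure ℝ) [IsProbabilityMeasure μ] (x : ℝ) : tailConv μ x ≠ ⊤ := by
  refine ((lintegral_mono (g := fun _ => 1) fun y =>
    mul_le_one' prob_le_one prob_le_one).trans_lt ?_).ne
  simp

lemma tailRegular_tailConv {μ : Measure ℝ} [IsProbabilityMeasure μ] (hμ : μ (Iio 0) = 0)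
    (hS : Negligible (fun x => (μ.conv μ) (Ioi x)) (tailConv μ)) :
    TailRegular 0 (tailConv μ) := by
  intro t d hd
  rw [zero_mul, Real.exp_zero] at hd
  have hd0 : 0 < d := by linarith
  rcases le_or_gt t 0 with ht | ht
  · have := hS.const_mul (c := ENNReal.ofReal (-t)) ENNReal.ofReal_ne_top
      (ENNReal.ofReal (d - 1)) (by simpa using hd)
    filter_upwards [this] with x hx
    have h1 := tailConv_le_shift hμ (neg_nonneg.2 ht) (x - t)
    rw [show x - t - -t = x by ring] at h1
    calc tailConv μ (x - t) ≤ tailConv μ x + ENNReal.ofReal (d - 1) * tailConv μ x :=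
          h1.trans (add_le_add_right hx _)
      _ = ENNReal.ofReal d * tailConv μ x := by
          rw [← one_add_mul, ← ENNReal.ofReal_one, ← ENNReal.ofReal_add zero_le_one (by linarith),
            add_sub_cancel]
  · have hd1 : d⁻¹ < 1 := inv_lt_one_of_one_lt₀ hd
    have := (hS.const_mul (c := ENNReal.ofReal t) ENNReal.ofReal_ne_top).comp_sub t
      (ENNReal.ofReal (1 - d⁻¹)) (by simpa using hd1)
    filter_upwards [this] with x hx
    -- The error is a small multiple of the left side itself; finiteness of `tailConv` allows its
    -- subtraction, leaving the fraction `d⁻¹`.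
    have h1 := (tailConv_shift_le ht.le x).trans (add_le_add_right hx (tailConv μ x))
    have h2 : tailConv μ (x - t) = ENNReal.ofReal d⁻¹ * tailConv μ (x - t) +
        ENNReal.ofReal (1 - d⁻¹) * tailConv μ (x - t) := by
      rw [← add_mul, ← ENNReal.ofReal_add (by positivity) (by linarith), add_sub_cancel,
        ENNReal.ofReal_one, one_mul]
    have h3 : ENNReal.ofReal d⁻¹ * tailConv μ (x - t) ≤ tailConv μ x := by
      rw [h2] at h1
      refine (ENNReal.add_le_add_iff_right
        (ENNReal.mul_ne_top ENNReal.ofReal_ne_top (tailConv_ne_top μ (x - t)))).1 (h1.trans ?_)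
      rw [← h2]
    calc tailConv μ (x - t) = ENNReal.ofReal d * (ENNReal.ofReal d⁻¹ * tailConv μ (x - t)) := by
          rw [← mul_assoc, ← ENNReal.ofReal_mul hd0.le, mul_inv_cancel₀ hd0.ne',
            ENNReal.ofReal_one, one_mul]
      _ ≤ _ := by gcongr

/-! ### The exponential transform of a law -/

section Transform

variable {γ : ℝ} {μ F : Measure ℝ}

lemma IsTransform.apply_Ioi_of_neg (h : IsTransform γ μ F) {x : ℝ} (hx : x < 0) :
    F (Ioi x) = 1 := by
  have := h.1
  have h1 := h.2 x
  rw [if_pos hx, tail] at h1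
  rw [← ofReal_measureReal (μ := F), h1, ENNReal.ofReal_one]

lemma IsTransform.apply_Iio_zero (h : IsTransform γ μ F) : F (Iio 0) = 0 := by
  have := h.1
  have hsub : Iio (0 : ℝ) ⊆ ⋃ n : ℕ, Iic (-(1 / ((n : ℝ) + 1))) := fun x hx => by
    obtain ⟨n, hn⟩ := exists_nat_one_div_lt (neg_pos.2 (mem_Iio.1 hx))
    exact mem_iUnion.2 ⟨n, by rw [mem_Iic]; linarith⟩
  refine measure_mono_null hsub (measure_iUnion_null fun n => ?_)
  rw [← compl_Ioi, prob_compl_eq_zero_iff measurableSet_Ioi]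
  exact h.apply_Ioi_of_neg (neg_lt_zero.2 (by positivity))

lemma lintegral_mul_exp_Ioo (hγ : 0 < γ) (x z : ℝ) :
    ∫⁻ y in Ioo x z, ENNReal.ofReal (γ * Real.exp (-γ * y)) =
      ENNReal.ofReal (Real.exp (-γ * x) - Real.exp (-γ * z)) := by
  rcases le_or_gt x z with hxz | hxz
  · have hcont : Continuous fun y : ℝ => γ * Real.exp (-γ * y) := by fun_prop
    rw [Measure.restrict_congr_set Ioo_ae_eq_Ioc, ← ofReal_integral_eq_lintegral_ofReal
      (hcont.integrableOn_Ioc) (Eventually.of_forall fun y => by positivity),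
      ← intervalIntegral.integral_of_le hxz]
    congr 1
    rw [intervalIntegral.integral_eq_sub_of_hasDerivAt (f := fun y => -Real.exp (-γ * y))
      (fun y _ => ?_) (hcont.intervalIntegrable _ _)]
    · ring
    · have h1 : HasDerivAt (fun y : ℝ => -γ * y) (-γ) y := by
        simpa using (hasDerivAt_id y).const_mul (-γ)
      exact h1.exp.neg.congr_deriv (by ring)
  · have : Real.exp (-γ * x) ≤ Real.exp (-γ * z) := Real.exp_le_exp.2 (by nlinarith)
    rw [Ioo_eq_empty (not_lt.2 hxz.le), ENNReal.ofReal_of_nonpos (by linarith)]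
    simp

/-- The density of the absolutely continuous part of a transform. -/
noncomputable def transformDensity (γ : ℝ) (μ : Measure ℝ) (y : ℝ) : ℝ≥0∞ :=
  ENNReal.ofReal (γ * Real.exp (-γ * y)) * μ (Ioi y)

lemma measurable_transformDensity : Measurable (transformDensity γ μ) :=
  Measurable.mul (by fun_prop) (measurable_measure_Ioi μ)

variable [IsProbabilityMeasure μ]

lemma IsTransform.apply_Ioi (h : IsTransform γ μ F) {x : ℝ} (hx : 0 ≤ x) :
    F (Ioi x) = ENNReal.ofReal (Real.exp (-γ * x)) * μ (Ioi x) := by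
  have := h.1
  have h1 := h.2 x
  rw [if_neg (not_lt.2 hx), tail, tail] at h1
  rw [← ofReal_measureReal (μ := F), h1, ENNReal.ofReal_mul (Real.exp_pos _).le,
    ofReal_measureReal]

lemma apply_Ioi_eq_one (hμ : μ (Iic 0) = 0) {x : ℝ} (hx : x ≤ 0) : μ (Ioi x) = 1 := by
  refine (prob_compl_eq_zero_iff measurableSet_Ioi).1 ?_
  rw [compl_Ioi]
  exact measure_mono_null (Iic_subset_Iic.2 hx) hμ

lemma lintegral_transformDensity (hγ : 0 < γ) (x : ℝ) :
    ∫⁻ y in Ioi x, transformDensity γ μ y =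
      ∫⁻ z in Ioi x, ENNReal.ofReal (Real.exp (-γ * x) - Real.exp (-γ * z)) ∂μ := by
  set E : Set (ℝ × ℝ) := {q | q.1 < q.2} with hE
  have hEm : MeasurableSet E := measurableSet_lt measurable_fst measurable_snd
  have h1 : ∀ y, transformDensity γ μ y = ∫⁻ z, ENNReal.ofReal (γ * Real.exp (-γ * y)) *
      E.indicator (1 : ℝ × ℝ → ℝ≥0∞) (y, z) ∂μ := by
    intro y
    rw [lintegral_const_mul' _ _ ENNReal.ofReal_ne_top, transformDensity,
      ← lintegral_indicator_one measurableSet_Ioi]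
    rfl
  simp_rw [h1]
  rw [lintegral_lintegral_swap]
  · have h2 : ∀ z, ∫⁻ y in Ioi x, ENNReal.ofReal (γ * Real.exp (-γ * y)) *
        E.indicator (1 : ℝ × ℝ → ℝ≥0∞) (y, z) =
        ENNReal.ofReal (Real.exp (-γ * x) - Real.exp (-γ * z)) := by
      intro z
      rw [← lintegral_mul_exp_Ioo hγ, ← Ioi_inter_Iio, inter_comm,
        ← Measure.restrict_restrict measurableSet_Iio, ← lintegral_indicator measurableSet_Iio]
      refine lintegral_congr fun y => ?_
      by_cases hyz : y < z
      · rw [indicator_of_mem (show (y, z) ∈ E from hyz), indicator_of_mem (mem_Iio.2 hyz)]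
        simp
      · rw [indicator_of_notMem (show (y, z) ∉ E from hyz), indicator_of_notMem (by simpa using hyz),
          mul_zero]
    simp_rw [h2]
    rw [← lintegral_add_compl _ (measurableSet_Ioi (a := x)), compl_Ioi,
      setLIntegral_congr_fun (g := fun _ => 0) measurableSet_Iic, lintegral_zero, add_zero]
    intro z hz
    have : Real.exp (-γ * x) ≤ Real.exp (-γ * z) :=
      Real.exp_le_exp.2 (by nlinarith [mem_Iic.1 hz])
    exact ENNReal.ofReal_of_nonpos (by linarith)
  · refine Measurable.aemeasurable ?_
    exact Measurable.mul (by fun_prop) (measurable_one.indicator hEm)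

/-- This is the product rule for `-d(e^{-γx} μ̄(x))`, checked on tails by Fubini; there is no atom
at `0` since `μ̄(0) = 1`. -/
lemma IsTransform.eq_add (hγ : 0 < γ) (hμ : μ (Iic 0) = 0) (h : IsTransform γ μ F) :
    F = μ.withDensity (fun y => ENNReal.ofReal (Real.exp (-γ * y))) +
      (volume.restrict (Ioi 0)).withDensity (transformDensity γ μ) := by
  have := h.1
  refine measure_ext_of_Ioi fun x => ?_
  set ρ := μ.withDensity (fun y => ENNReal.ofReal (Real.exp (-γ * y))) +
      (volume.restrict (Ioi 0)).withDensity (transformDensity γ μ) with hρ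
  have hpos : ∀ x, 0 ≤ x →
      ρ (Ioi x) = ENNReal.ofReal (Real.exp (-γ * x)) * μ (Ioi x) := by
    intro x hx
    rw [hρ, Measure.add_apply, withDensity_apply _ measurableSet_Ioi,
      withDensity_apply _ measurableSet_Ioi, Measure.restrict_restrict measurableSet_Ioi,
      Ioi_inter_Ioi, sup_of_le_left hx, lintegral_transformDensity hγ,
      ← lintegral_add_left (by fun_prop), ← setLIntegral_const]
    refine setLIntegral_congr_fun measurableSet_Ioi fun z hz => ?_
    have : Real.exp (-γ * z) ≤ Real.exp (-γ * x) :=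
      Real.exp_le_exp.2 (by nlinarith [mem_Ioi.1 hz])
    rw [← ENNReal.ofReal_add (Real.exp_pos _).le (by linarith), add_sub_cancel]
  rcases le_or_gt 0 x with hx | hx
  · rw [hpos x hx, h.apply_Ioi hx]
  · have hnull : ρ (Iic 0) = 0 := by
      rw [hρ, Measure.add_apply, withDensity_absolutelyContinuous _ _ hμ, zero_add]
      refine withDensity_absolutelyContinuous _ _ ?_
      rw [Measure.restrict_apply measurableSet_Iic, Iic_inter_Ioi, Ioc_self, measure_empty]
    rw [h.apply_Ioi_of_neg hx, ← Ioc_union_Ioi_eq_Ioi hx.le,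
      measure_union (Ioc_disjoint_Ioi le_rfl) measurableSet_Ioi,
      measure_mono_null Ioc_subset_Iic_self hnull, hpos 0 le_rfl,
      apply_Ioi_eq_one hμ le_rfl]
    simp

/-- For `y ≤ x` the exponential weights at `y` and `x - y` multiply to `e^{-γx}`. Thus the weighted
part of `F` produces the tail of `μ * μ` and the density part produces `tailConv μ`; for `y > x`
both convolutions contribute a plain tail at `x`. -/
lemma IsTransform.conv_apply_Ioi (hγ : 0 < γ) (hμ : μ (Iic 0) = 0) (h : IsTransform γ μ F)
    {x : ℝ} (hx : 0 ≤ x) :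
    (F.conv F) (Ioi x) = ENNReal.ofReal (Real.exp (-γ * x)) *
      ((μ.conv μ) (Ioi x) + ENNReal.ofReal γ * tailConv μ x) := by
  have := h.1
  have hm := measurable_measure_Ioi_sub F x
  have hexp : ∀ y ≤ x, ENNReal.ofReal (Real.exp (-γ * y)) * F (Ioi (x - y)) =
      ENNReal.ofReal (Real.exp (-γ * x)) * μ (Ioi (x - y)) := by
    intro y hy
    rw [h.apply_Ioi (by linarith), ← mul_assoc, ← ENNReal.ofReal_mul (Real.exp_pos _).le,
      ← Real.exp_add]
    congr 4
    ring
  have hF : ∫⁻ y in Ioi x, F (Ioi (x - y)) ∂F = ENNReal.ofReal (Real.exp (-γ * x)) * μ (Ioi x) := by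
    rw [← h.apply_Ioi hx, ← one_mul (F (Ioi x)), ← setLIntegral_const]
    exact setLIntegral_congr_fun measurableSet_Ioi fun y hy =>
      h.apply_Ioi_of_neg (sub_neg.2 hy)
  have hM : ∫⁻ y in Ioi x, μ (Ioi (x - y)) ∂μ = μ (Ioi x) := by
    rw [← one_mul (μ (Ioi x)), ← setLIntegral_const]
    exact setLIntegral_congr_fun measurableSet_Ioi fun y hy =>
      apply_Ioi_eq_one hμ (sub_neg.2 hy).le
  have hD1 : ∫⁻ y in Iic x, F (Ioi (x - y))
      ∂μ.withDensity (fun y => ENNReal.ofReal (Real.exp (-γ * y))) =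
      ENNReal.ofReal (Real.exp (-γ * x)) * ∫⁻ y in Iic x, μ (Ioi (x - y)) ∂μ := by
    rw [restrict_withDensity measurableSet_Iic,
      lintegral_withDensity_eq_lintegral_mul _ (by fun_prop) hm,
      ← lintegral_const_mul _ (measurable_measure_Ioi_sub μ x)]
    exact setLIntegral_congr_fun measurableSet_Iic fun y hy => hexp y hy
  have hD2 : ∫⁻ y in Iic x, F (Ioi (x - y))
      ∂(volume.restrict (Ioi 0)).withDensity (transformDensity γ μ) =
      ENNReal.ofReal (Real.exp (-γ * x)) * (ENNReal.ofReal γ * tailConv μ x) := by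
    rw [restrict_withDensity measurableSet_Iic,
      lintegral_withDensity_eq_lintegral_mul _ measurable_transformDensity hm,
      Measure.restrict_restrict measurableSet_Iic, Iic_inter_Ioi, tailConv,
      Measure.restrict_congr_set Ioc_ae_eq_Icc.symm, ← mul_assoc,
      ← lintegral_const_mul _ (measurable_tail_mul_tail μ μ x)]
    refine setLIntegral_congr_fun measurableSet_Ioc fun y hy => ?_
    simp only [Pi.mul_apply, transformDensity]
    rw [ENNReal.ofReal_mul hγ.le]
    calc _ = ENNReal.ofReal γ * μ (Ioi y) *
          (ENNReal.ofReal (Real.exp (-γ * y)) * F (Ioi (x - y))) := by ring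
      _ = _ := by
          rw [hexp y hy.2]
          ring
  rw [ConvRoots.conv_apply_Ioi, ← lintegral_add_compl _ (measurableSet_Iic (a := x)), compl_Iic,
    hF, ConvRoots.conv_apply_Ioi μ, ← lintegral_add_compl (μ := μ) _ (measurableSet_Iic (a := x)),
    compl_Iic, hM]
  have hsplit : ∫⁻ y in Iic x, F (Ioi (x - y)) ∂F =
      ENNReal.ofReal (Real.exp (-γ * x)) * ∫⁻ y in Iic x, μ (Ioi (x - y)) ∂μ +
      ENNReal.ofReal (Real.exp (-γ * x)) * (ENNReal.ofReal γ * tailConv μ x) := by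
    conv_lhs => rw [h.eq_add hγ hμ]
    rw [Measure.restrict_add, lintegral_add_measure, ← h.eq_add hγ hμ, hD1, hD2]
  rw [hsplit]
  ring

lemma IsTransform.expMoment_eq_top (hγ : 0 < γ) (hμ : μ (Iic 0) = 0) (h : IsTransform γ μ F)
    (hmean : ∫⁻ y in Ioi 0, μ (Ioi y) = ⊤) : expMoment γ F = ⊤ := by
  refine top_unique ?_
  calc ⊤ = ENNReal.ofReal γ * ∫⁻ y in Ioi 0, μ (Ioi y) := by
        rw [hmean, ENNReal.mul_top (ENNReal.ofReal_pos.2 hγ).ne']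
    _ = ∫⁻ y in Ici 0, ENNReal.ofReal (Real.exp (γ * y))
          ∂(volume.restrict (Ioi 0)).withDensity (transformDensity γ μ) := by
        rw [restrict_withDensity measurableSet_Ici,
          lintegral_withDensity_eq_lintegral_mul _ measurable_transformDensity (by fun_prop),
          Measure.restrict_restrict measurableSet_Ici, inter_eq_right.2 Ioi_subset_Ici_self,
          ← lintegral_const_mul _ (measurable_measure_Ioi μ)]
        refine lintegral_congr fun y => ?_
        simp only [Pi.mul_apply, transformDensity]
        rw [mul_right_comm, ← ENNReal.ofReal_mul (by positivity), mul_assoc γ, ← Real.exp_add]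
        simp
    _ ≤ _ := by
        rw [expMoment]
        conv_rhs => rw [h.eq_add hγ hμ]
        rw [Measure.restrict_add, lintegral_add_measure]
        exact le_add_self

lemma IsTransform.tailRegular_convPow_two (hγ : 0 < γ) (hμ : μ (Iic 0) = 0)
    (h : IsTransform γ μ F)
    (hS : Negligible (fun x => (μ.conv μ) (Ioi x)) (tailConv μ)) :
    TailRegular γ fun x => convPow F 2 (Ioi x) := by
  have := h.1
  intro t c hc
  set d := c * Real.exp (-(γ * t)) with hd
  have hd1 : 1 < d := by
    have := mul_lt_mul_of_pos_right hc (Real.exp_pos (-(γ * t)))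
    rwa [← Real.exp_add, add_neg_cancel, Real.exp_zero] at this
  -- The slack `d = c e^{-γt} > 1` is shared out: shifting `tailConv` costs `d'`, and absorbing the
  -- tail of `μ * μ` costs `d / d'`.
  obtain ⟨d', hd'1, hd'd⟩ := exists_between hd1
  have hd'0 : 0 < d' := by linarith
  have hη : 0 < γ * (d / d' - 1) := by
    refine mul_pos hγ (sub_pos.2 ?_)
    rwa [one_lt_div hd'0]
  have hH := tailRegular_tailConv (measure_mono_null Iio_subset_Iic_self hμ) hS t d'
    (by simpa using hd'1)
  have hS' := hS.comp_sub t (ENNReal.ofReal (γ * (d / d' - 1))) (ENNReal.ofReal_pos.2 hη).ne'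
  filter_upwards [hH, hS', eventually_ge_atTop 0, eventually_ge_atTop t] with x hx1 hx2 hx0 hxt
  simp only [convPow_two]
  rw [h.conv_apply_Ioi hγ hμ hx0, h.conv_apply_Ioi hγ hμ (sub_nonneg.2 hxt)]
  have hmain : (μ.conv μ) (Ioi (x - t)) + ENNReal.ofReal γ * tailConv μ (x - t) ≤
      ENNReal.ofReal d * (ENNReal.ofReal γ * tailConv μ x) := by
    calc _ ≤ ENNReal.ofReal (γ * (d / d' - 1)) * tailConv μ (x - t) +
          ENNReal.ofReal γ * tailConv μ (x - t) := add_le_add_left hx2 _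
      _ = ENNReal.ofReal (γ * (d / d')) * tailConv μ (x - t) := by
          rw [← add_mul, ← ENNReal.ofReal_add hη.le hγ.le]
          congr 2
          ring
      _ ≤ ENNReal.ofReal (γ * (d / d')) * (ENNReal.ofReal d' * tailConv μ x) := by gcongr
      _ = _ := by
          rw [← mul_assoc, ← mul_assoc, ← ENNReal.ofReal_mul (by positivity),
            ← ENNReal.ofReal_mul (by linarith)]
          congr 2
          field_simp
  calc _ ≤ ENNReal.ofReal (Real.exp (-γ * (x - t))) *
        (ENNReal.ofReal d * (ENNReal.ofReal γ * tailConv μ x)) := by gcongr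
    _ = ENNReal.ofReal c * (ENNReal.ofReal (Real.exp (-γ * x)) *
        (ENNReal.ofReal γ * tailConv μ x)) := by
        have hexp : Real.exp (-γ * (x - t)) * d = c * Real.exp (-γ * x) := by
          rw [hd, mul_left_comm, ← Real.exp_add]
          congr 2
          ring
        rw [← mul_assoc, ← mul_assoc (ENNReal.ofReal c), ← ENNReal.ofReal_mul (Real.exp_pos _).le,
          ← ENNReal.ofReal_mul ((Real.exp_pos _).le.trans hc.le), hexp]
    _ ≤ _ := by
        gcongr
        exact le_add_self

lemma IsTransform.negligible_convPow_two (hγ : 0 < γ) (hμ : μ (Iic 0) = 0)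
    (h : IsTransform γ μ F) (hmean : ∫⁻ y in Ioi 0, μ (Ioi y) = ⊤) :
    Negligible (fun x => F (Ioi x)) fun x => convPow F 2 (Ioi x) := by
  have := h.1
  intro ε hε
  have hN := (negligible_tail_shift hmean 0) (ε * ENNReal.ofReal γ)
    (mul_ne_zero hε (ENNReal.ofReal_pos.2 hγ).ne')
  filter_upwards [hN, eventually_ge_atTop 0] with x hx hx0
  rw [sub_zero] at hx
  simp only [convPow_two]
  rw [h.apply_Ioi hx0, h.conv_apply_Ioi hγ hμ hx0, mul_left_comm]
  gcongr
  rw [mul_assoc] at hx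
  exact hx.trans (by gcongr; exact le_add_self)

lemma IsTransform.apply_Ioi_ne_zero (h : IsTransform γ μ F) (hpos : ∀ x, μ (Ioi x) ≠ 0) (x : ℝ) :
    F (Ioi x) ≠ 0 := by
  rcases lt_or_ge x 0 with hx | hx
  · simp [h.apply_Ioi_of_neg hx]
  · rw [h.apply_Ioi hx]
    exact mul_ne_zero (ENNReal.ofReal_pos.2 (Real.exp_pos _)).ne' (hpos x)

lemma IsTransform.liminfCondition (h : IsTransform γ μ F) (hpos : ∀ x, μ (Ioi x) ≠ 0) :
    LiminfCondition γ F := by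
  have := h.1
  intro t ht
  refine le_liminf_of_le (by isBoundedDefault) ?_
  filter_upwards [eventually_ge_atTop t] with x hx
  rw [ENNReal.le_div_iff_mul_le (Or.inl (h.apply_Ioi_ne_zero hpos x))
    (Or.inl (measure_ne_top _ _)), h.apply_Ioi (ht.le.trans hx), h.apply_Ioi (sub_nonneg.2 hx),
    ← mul_assoc, ← ENNReal.ofReal_mul (Real.exp_pos _).le, ← Real.exp_add,
    show γ * t + -γ * x = -γ * (x - t) by ring]
  gcongr
  linarith

end Transform

/-! ### The collapse of the tail at block ends -/

lemma IsBlockMixture.eventually_mul_tail_le {s K : ℝ} {μ : Measure ℝ} {p b e : ℕ → ℝ}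
    {ν : ℕ → Measure ℝ} (h : IsBlockMixture s K μ p b e ν) (r : ℝ) :
    ∀ᶠ n in atTop, ENNReal.ofReal r * μ (Ioi (e n)) ≤ μ (Ioi (e n - 1)) := by
  -- The tail is at least `pₙ / bₙ` at `eₙ - 1` and at most `K pₙ bₙ^{-s}` at `eₙ`, so the quotient
  -- is at least `bₙ^{s-1} / K`, which is unbounded as `s > 1`.
  have hlim := (tendsto_rpow_atTop (sub_pos.2 h.one_lt)).comp h.tendsto_left
  filter_upwards [hlim.eventually_ge_atTop (r * K), h.tendsto_left.eventually_ge_atTop 4]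
    with n hn hn4
  have hb := h.left_pos n
  have hp := h.weight_pos n
  rcases le_or_gt r 0 with hr | hr
  · simp [ENNReal.ofReal_of_nonpos hr]
  have h1 : μ (Ioi (e n)) ≤ ENNReal.ofReal (K * p (n + 1)) :=
    h.tail_le fun k hk => h.strictMono_right.monotone (Nat.lt_succ_iff.1 hk)
  have h2 := h.le_tail_of_mem (n := n) (z := e n - 1)
    ⟨by linarith [h.left_le_right n], by linarith⟩
  refine le_trans ?_ h2
  calc ENNReal.ofReal r * μ (Ioi (e n)) ≤ ENNReal.ofReal r * ENNReal.ofReal (K * p (n + 1)) := by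
        gcongr
    _ = ENNReal.ofReal (r * (K * p (n + 1))) := (ENNReal.ofReal_mul hr.le).symm
    _ ≤ _ := by
        refine ENNReal.ofReal_le_ofReal ?_
        have h3 : b n ^ (s - 1) * b n ^ (-s) = 1 / b n := by
          rw [← Real.rpow_add hb, one_div, ← Real.rpow_neg_one]
          congr 1
          ring
        have hn' : r * K ≤ b n ^ (s - 1) := hn
        calc r * (K * p (n + 1)) = p n * (r * K * b n ^ (-s)) := by
              rw [h.weight_succ]
              ring
          _ ≤ p n * (b n ^ (s - 1) * b n ^ (-s)) := by gcongr
          _ = _ := by rw [h3, sub_sub_cancel]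

lemma IsBlockMixture.transform_notMem_classOL {γ s K : ℝ} (hγ : 0 < γ) {μ F : Measure ℝ}
    {p b e : ℕ → ℝ} {ν : ℕ → Measure ℝ} (h : IsBlockMixture s K μ p b e ν)
    (hF : IsTransform γ μ F) : F ∉ classOL := by
  have := hF.1
  have := h.isProbabilityMeasure
  intro hOL
  obtain ⟨k, hk1, hk2⟩ := exists_between (hOL 1 one_ne_zero)
  have hev : ∀ᶠ x in atTop, F (Ioi (x - 1)) / F (Ioi x) < k := eventually_lt_of_limsup_lt hk1
  have hetop : Tendsto e atTop atTop :=
    tendsto_atTop_mono (fun n => (h.left_lt_right n).le) h.tendsto_left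
  obtain ⟨n, hn1, hn2, hn3⟩ := ((hetop.eventually hev).and
    ((h.eventually_mul_tail_le (k.toReal + 1)).and (hetop.eventually_ge_atTop 1))).exists
  have hpos := h.tail_ne_zero (e n)
  rw [ENNReal.div_lt_iff (Or.inl (hF.apply_Ioi_ne_zero h.tail_ne_zero _))
    (Or.inl (measure_ne_top _ _)), hF.apply_Ioi (by linarith), hF.apply_Ioi (by linarith)] at hn1
  have hexp : ENNReal.ofReal (Real.exp (-γ * e n)) ≤ ENNReal.ofReal (Real.exp (-γ * (e n - 1))) :=
    ENNReal.ofReal_le_ofReal (Real.exp_le_exp.2 (by linarith))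
  have hlt := (mul_le_mul' hexp hn2).trans_lt hn1
  rw [mul_left_comm k] at hlt
  have hlt' := lt_of_mul_lt_mul_right' (lt_of_mul_lt_mul_left' hlt)
  rw [ENNReal.ofReal_add ENNReal.toReal_nonneg zero_le_one, ENNReal.ofReal_toReal hk2.ne] at hlt'
  exact absurd hlt' (not_lt.2 le_self_add)

end ConvRoots

/-! ### The proposition -/

theorem proposition5p2 (γ : ℝ) (hγ : 0 < γ) (F : MeasureTheory.Measure ℝ)
    (hF : F ∈ ConvRoots.classF2 γ) :
    ConvRoots.LiminfCondition γ F ∧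
    ConvRoots.LittleOCondition F ∧
    ConvRoots.expMoment γ F = ⊤ ∧
    (∀ k : ℕ, 2 ≤ k →
      ConvRoots.convPow F k ∈ ConvRoots.classL γ \ ConvRoots.classOS) ∧
    F ∉ ConvRoots.classOL ∧
    (∀ τ : PMF ℕ, (∃ k : ℕ, 2 ≤ k ∧ 0 < τ k) → ConvRoots.RandomCondition F τ →
      ConvRoots.randomConv F τ ∈ ConvRoots.classL γ \ ConvRoots.classOS) := by
  obtain ⟨_, ⟨s, α, a, hs1, hs2, hα1, hα2, ha, har, rfl⟩, hT⟩ := hF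
  have hprob := hT.1
  have hB := ConvRoots.isBlockMixture_xiLaw hs1 hs2 hα1 hα2 ha har
  have hprob' := hB.isProbabilityMeasure
  have hN := hT.negligible_convPow_two hγ hB.measure_Iic_zero hB.lintegral_tail
  have hL := hT.tailRegular_convPow_two hγ hB.measure_Iic_zero hB.negligible_conv
  have hm := hT.expMoment_eq_top hγ hB.measure_Iic_zero hB.lintegral_tail
  have hrandom : ∀ τ : PMF ℕ, (∃ k : ℕ, 2 ≤ k ∧ 0 < τ k) → ConvRoots.RandomCondition F τ →
      ConvRoots.randomConv F τ ∈ ConvRoots.classL γ \ ConvRoots.classOS := fun τ hτ₂ hτ =>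
    ConvRoots.randomConv_mem_classL_diff_classOS hT.apply_Iio_zero
      (hT.apply_Ioi_ne_zero hB.tail_ne_zero) hL hN hm hτ₂ hτ
  refine ⟨hT.liminfCondition hB.tail_ne_zero, ConvRoots.isLittleO_tail hN, hm, fun k hk => ?_,
    hB.transform_notMem_classOL hγ hT, hrandom⟩
  rw [← ConvRoots.randomConv_pure k]
  exact hrandom _ ⟨k, hk, by simp⟩ (ConvRoots.randomCondition_pure k)
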